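/- For $a>0$ and an integer $j\ge 1$ let $F_{a,j}$ be the distribution function of the Erlang distribution with density $a^{j}x^{j-1}e^{-ax}/\Gamma(j)$, $x>0$. Let $0<a_1<\dots<a_n$, and let $p_{ij}\ge 0$ ($1\le i\le n$, $j\ge 1$) satisfy $p:=\sum_{i=1}^n\sum_{j=1}^\infty p_{ij}\le 1$. Let $$F(x)=(1-p)+\sum_{i=1}^{n}\sum_{j=1}^{\infty}p_{ij}F_{a_i,j}(x),\qquad x\ge 0,$$ a (possibly infinite) mixture of Erlang distributions with a possible atom at $0$. Let $(S(u))_{u\ge 0}$ be the gamma process with $S(0)=0$ and, for $u>0$, $S(u)$ having density $x^{u-1}e^{-x}/\Gamma(u)$, $x>0$. For $t>0$ and a function $g$ on $[0,\infty)$ put $L_t g(x)=E\,g(S(tx)/t)$ for $x\ge 0$ (defined when $E|g(S(tx)/t)|<\infty$ for all $t>0$, $x\ge0$), $L_t^{[2]}g=2L_{2t}g-L_tg$, and $$M_t^{[2]}g(x)=(tx-[tx])\,L_t^{[2]}g\Bigl(\tfrac{[tx]+1}{t}\Bigr)+([tx]+1-tx)\,L_t^{[2]}g\Bigl(\tfrac{[tx]}{t}\Bigr),\qquad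 x\ge 0,$$ where $[y]$ is the integer part of $y$. Write $\|f\|=\sup_{x\ge 0}|f(x)|$. Then these operators are well defined at $F$, and for every $t>0$, $$\bigl\|M_t^{[2]}F-F\bigr\|\le\Bigl(\frac{17}{12}+\frac{27}{16e}\Bigr)\,\frac{\sum_{i=1}^{n}\bigl(\sum_{j=1}^{\infty}p_{ij}\bigr)a_i^{2}}{t^{2}}.$$ -/

import Mathlib

open MeasureTheory ProbabilityTheory
open scoped ENNReal

noncomputable section

/-- The law of `S(u)`, `u ≥ 0`, where `S` is the standard gamma process: `S(0) = 0`, and for `u > 0`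
the variable `S(u)` has the gamma density `x ^ (u - 1) * exp (-x) / Γ(u)` on `x > 0`. -/
def gammaProcessLaw (u : ℝ) : Measure ℝ :=
  if u = 0 then Measure.dirac 0 else gammaMeasure u 1

/-- The gamma-type operator `L_t g(x) = E g(S(t x) / t)`, for `t > 0` and `x ≥ 0`. -/
def gammaOp (t : ℝ) (g : ℝ → ℝ) (x : ℝ) : ℝ :=
  ∫ s, g (s / t) ∂(gammaProcessLaw (t * x))

/-- `g` is in the domain of the operators `L_t`: `E |g(S(t x) / t)| < ∞` for all `t > 0`, `x ≥ 0`. -/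
def GammaOpDefined (g : ℝ → ℝ) : Prop :=
  ∀ t : ℝ, 0 < t → ∀ x : ℝ, 0 ≤ x →
    Integrable (fun s => g (s / t)) (gammaProcessLaw (t * x))

/-- The accelerated (Richardson) operator `L_t^{[2]} g = 2 L_{2t} g - L_t g`. -/
def gammaOpTwo (t : ℝ) (g : ℝ → ℝ) (x : ℝ) : ℝ :=
  2 * gammaOp (2 * t) g x - gammaOp t g x

/-- The operator `M_t^{[2]}`, for `t > 0` and `x ≥ 0`: linear interpolation of `L_t^{[2]} g` between
the points `k / t`, `k ∈ ℕ`. -/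
def interpOpTwo (t : ℝ) (g : ℝ → ℝ) (x : ℝ) : ℝ :=
  (t * x - ⌊t * x⌋₊) * gammaOpTwo t g ((⌊t * x⌋₊ + 1) / t)
    + (⌊t * x⌋₊ + 1 - t * x) * gammaOpTwo t g (⌊t * x⌋₊ / t)

/-- The sup-norm over `[0, ∞)`, as an extended non-negative real. -/
def supNormNonneg (f : ℝ → ℝ) : ℝ≥0∞ :=
  ⨆ x : Set.Ici (0 : ℝ), ENNReal.ofReal |f x|

/-- The distribution function of the Erlang `j` distribution with parameter `a`, whose density is
`a ^ j * x ^ (j - 1) * exp (-a x) / Γ(j)` on `x > 0`. -/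
def erlangCDF (a : ℝ) (j : ℕ+) (x : ℝ) : ℝ :=
  cdf (gammaMeasure (j : ℕ) a) x

/-- `F` is, on `[0, ∞)`, the mixture of Erlang distributions with parameters `a i` and weights
`p i j`, with the remaining mass `1 - ∑ i, ∑ j, p i j` put at the point `0`. -/
structure IsErlangMixture {n : ℕ} (a : Fin n → ℝ) (p : Fin n → ℕ+ → ℝ) (F : ℝ → ℝ) : Prop where
  param_pos : ∀ i, 0 < a i
  param_strictMono : StrictMono a
  weight_nonneg : ∀ i j, 0 ≤ p i j
  weight_summable : ∀ i, Summable (p i)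
  weight_sum_le_one : ∑ i, ∑' j, p i j ≤ 1
  eq_mixture : ∀ x, 0 ≤ x →
    F x = (1 - ∑ i, ∑' j, p i j) + ∑ i, ∑' j, p i j * erlangCDF (a i) j x

end

/-! The Poisson weight `σ ^ k * exp (-σ) / k!` is the `k`-th Fourier coefficient of `exp (-σθ)`,
where `θ = 1 - exp (iφ)`. Integrating in the scale gives `F_{a,k+1}(x)` as the mean over `φ` of `exp
(-ikφ) (1 - exp (-axθ)) / θ` (`erlangCDF_eq_symbolMean`). At `x = m / t`, applying `L_t` replaces
the exponential by the Laplace transform `(1 + ρθ)⁻¹ ^ m`, `ρ = a / t`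
(`gammaOp_erlangCDF_eq_symbolMean`). Only the unimodular factor depends on the shape, so bounds on
symbols are uniform in it, and infinite mixtures cost nothing.

With `z = ρθ / 2`, the error symbol of `L_t^{[2]}` is `(1 + 2z)⁻¹ ^ m + exp (-2z) ^ m - 2 (1 + z)⁻¹
^ (2m)`. For `m = 1` the quadratic terms cancel, leaving `O(z³)`; the `m`-th power gives `m |z|³ +
m² |z|⁴` times a decaying factor (`norm_kernel_pow_le`). Since `‖θ‖² = 2 Re θ`, this decay absorbs
the powers of `m`: after division by `θ` the mean is at most a constant times `ρ²`
(`exists_majorant_kernel_pow`).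

Linear interpolation adds a second order Taylor error in the same representation
(`abs_interp_erlangCDF_sub_le`). This settles `a ≤ t`; for `a > t` the crude bound 2 is enough.
Mixtures follow by linearity. -/

namespace ErlangMixture

/-! ### Taylor estimates for the exponential on the right half-plane -/

lemma hasDerivAt_exp_neg_mul (z : ℂ) (s : ℝ) :
    HasDerivAt (fun u : ℝ => Complex.exp (-(u * z))) (-z * Complex.exp (-(s * z))) s := by
  have h1 : HasDerivAt (fun u : ℝ => -((u : ℂ) * z)) (-z) s := by
    simpa using ((Complex.ofRealCLM.hasDerivAt (x := s)).mul_const z).fun_neg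
  have := h1.cexp
  rwa [mul_comm] at this

lemma norm_exp_neg_le_one {z : ℂ} (hz : 0 ≤ z.re) : ‖Complex.exp (-z)‖ ≤ 1 := by
  rw [Complex.norm_exp]
  simpa using hz

lemma norm_exp_neg_mul_le_one {z : ℂ} (hz : 0 ≤ z.re) {s : ℝ} (hs : 0 ≤ s) :
    ‖Complex.exp (-(s * z))‖ ≤ 1 :=
  norm_exp_neg_le_one (by simpa using mul_nonneg hs hz)

/-- On the right half-plane, `exp (-z)` is a contraction. -/
lemma norm_one_sub_exp_neg_le {z : ℂ} (hz : 0 ≤ z.re) : ‖1 - Complex.exp (-z)‖ ≤ ‖z‖ := by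
  have h := image_norm_le_of_norm_deriv_right_le_deriv_boundary
    (f := fun s : ℝ => 1 - Complex.exp (-(s * z))) (a := 0) (b := 1)
    (f' := fun s => z * Complex.exp (-(s * z))) (B := fun s => s * ‖z‖) (B' := fun _ => ‖z‖)
    (by fun_prop)
    (fun s _ => by
      simpa using ((hasDerivAt_exp_neg_mul z s).const_sub 1).hasDerivWithinAt)
    (by simp) (fun s => by simpa using (hasDerivAt_id s).mul_const ‖z‖)
    (fun s hs => by
      rw [norm_mul]
      exact mul_le_of_le_one_right (norm_nonneg _) (norm_exp_neg_mul_le_one hz hs.1))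
  simpa using h (Set.right_mem_Icc.2 zero_le_one)

lemma hasDerivAt_one_add_mul_exp_neg (z : ℂ) (s : ℝ) :
    HasDerivAt (fun u : ℝ => (1 + u * z) * Complex.exp (-(u * z)))
      (-(s * z ^ 2 * Complex.exp (-(s * z)))) s := by
  have h1 : HasDerivAt (fun u : ℝ => 1 + (u : ℂ) * z) z s := by
    simpa using ((Complex.ofRealCLM.hasDerivAt (x := s)).mul_const z).const_add 1
  refine (h1.mul (hasDerivAt_exp_neg_mul z s)).congr_deriv ?_
  ring

/-- Along `s ↦ sz` the derivative is `-s z² exp (-sz)`, of norm at most `s ‖z‖²`; integrate over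
`[0, 1]`. -/
lemma norm_one_add_mul_exp_neg_sub_one_le {z : ℂ} (hz : 0 ≤ z.re) :
    ‖(1 + z) * Complex.exp (-z) - 1‖ ≤ ‖z‖ ^ 2 / 2 := by
  have h := image_norm_le_of_norm_deriv_right_le_deriv_boundary
    (f := fun s : ℝ => (1 + s * z) * Complex.exp (-(s * z)) - 1) (a := 0) (b := 1)
    (f' := fun s => -(s * z ^ 2 * Complex.exp (-(s * z))))
    (B := fun s => s ^ 2 * ‖z‖ ^ 2 / 2) (B' := fun s => s * ‖z‖ ^ 2)
    (by fun_prop)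
    (fun s _ => ((hasDerivAt_one_add_mul_exp_neg z s).sub_const 1).hasDerivWithinAt)
    (by simp)
    (fun s => by
      refine (((hasDerivAt_pow 2 s).mul_const (‖z‖ ^ 2)).div_const 2).congr_deriv ?_
      push_cast; ring)
    (fun s hs => by
      rw [norm_neg, norm_mul, norm_mul, norm_pow, Complex.norm_real, Real.norm_of_nonneg hs.1]
      exact mul_le_of_le_one_right (mul_nonneg hs.1 (by positivity))
        (norm_exp_neg_mul_le_one hz hs.1))
  simpa using h (Set.right_mem_Icc.2 zero_le_one)

/-- The quadratic correction turns the derivative into `s z² (1 - exp (-sz))`, and the contraction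
estimate gains one more factor `s ‖z‖`. -/
lemma norm_one_add_mul_exp_neg_sub_one_add_le {z : ℂ} (hz : 0 ≤ z.re) :
    ‖(1 + z) * Complex.exp (-z) - 1 + z ^ 2 / 2‖ ≤ ‖z‖ ^ 3 / 3 := by
  have h := image_norm_le_of_norm_deriv_right_le_deriv_boundary
    (f := fun s : ℝ => (1 + s * z) * Complex.exp (-(s * z)) - 1 + (s : ℂ) ^ 2 * (z ^ 2 / 2))
    (a := 0) (b := 1)
    (f' := fun s => s * z ^ 2 * (1 - Complex.exp (-(s * z))))
    (B := fun s => s ^ 3 * ‖z‖ ^ 3 / 3) (B' := fun s => s ^ 2 * ‖z‖ ^ 3)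
    (by fun_prop)
    (fun s _ => by
      have h2 : HasDerivAt (fun u : ℝ => (u : ℂ) ^ 2 * (z ^ 2 / 2)) (s * z ^ 2) s := by
        refine (((Complex.ofRealCLM.hasDerivAt (x := s)).pow 2).mul_const (z ^ 2 / 2)).congr_deriv ?_
        simp; ring
      refine ((((hasDerivAt_one_add_mul_exp_neg z s).sub_const 1).add
        h2).congr_deriv ?_).hasDerivWithinAt
      ring)
    (by simp)
    (fun s => by
      refine (((hasDerivAt_pow 3 s).mul_const (‖z‖ ^ 3)).div_const 3).congr_deriv ?_
      push_cast; ring)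
    (fun s hs => by
      rw [norm_mul, norm_mul, norm_pow, Complex.norm_real, Real.norm_of_nonneg hs.1]
      have h3 : ‖1 - Complex.exp (-(s * z))‖ ≤ s * ‖z‖ := by
        refine (norm_one_sub_exp_neg_le (z := s * z) ?_).trans ?_
        · simpa using mul_nonneg hs.1 hz
        · rw [norm_mul, Complex.norm_real, Real.norm_of_nonneg hs.1]
      calc s * ‖z‖ ^ 2 * ‖1 - Complex.exp (-(s * z))‖ ≤ s * ‖z‖ ^ 2 * (s * ‖z‖) :=
            mul_le_mul_of_nonneg_left h3 (mul_nonneg hs.1 (by positivity))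
        _ = s ^ 2 * ‖z‖ ^ 3 := by ring)
  simpa using h (Set.right_mem_Icc.2 zero_le_one)

/-- Second order Taylor estimate for `exp (-·)` on the right half-plane. -/
lemma norm_exp_neg_taylor_two_le {u v : ℂ} (hu : 0 ≤ u.re) (hv : 0 ≤ v.re) :
    ‖Complex.exp (-v) - Complex.exp (-u) + (v - u) * Complex.exp (-u)‖ ≤ ‖v - u‖ ^ 2 / 2 := by
  -- The half-plane is convex, so the exponential stays bounded by 1 on the segment from `u` to `v`.
  have hre : ∀ s : ℝ, 0 ≤ s → s ≤ 1 → ‖Complex.exp (-u) * Complex.exp (-(s * (v - u)))‖ ≤ 1 := by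
    intro s h0 h1
    rw [← Complex.exp_add, ← neg_add]
    refine norm_exp_neg_le_one ?_
    have : (u + s * (v - u)).re = (1 - s) * u.re + s * v.re := by simp; ring
    rw [this]
    exact add_nonneg (mul_nonneg (by linarith) hu) (mul_nonneg h0 hv)
  have h1 := image_norm_le_of_norm_deriv_right_le_deriv_boundary
    (f := fun s : ℝ => Complex.exp (-u) * (Complex.exp (-(s * (v - u))) - 1))
    (a := 0) (b := 1)
    (f' := fun s => Complex.exp (-u) * (-(v - u) * Complex.exp (-(s * (v - u)))))
    (B := fun s => s * ‖v - u‖) (B' := fun _ => ‖v - u‖)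
    (by fun_prop)
    (fun s _ => (((hasDerivAt_exp_neg_mul (v - u) s).sub_const 1).const_mul _).hasDerivWithinAt)
    (by simp) (fun s => by simpa using (hasDerivAt_id s).mul_const ‖v - u‖)
    (fun s hs => by
      have := hre s hs.1 hs.2.le
      calc _ = ‖v - u‖ * ‖Complex.exp (-u) * Complex.exp (-(s * (v - u)))‖ := by
            simp only [norm_mul, norm_neg]; ring
        _ ≤ _ := mul_le_of_le_one_right (norm_nonneg _) this)
  have h2 := image_norm_le_of_norm_deriv_right_le_deriv_boundary
    (f := fun s : ℝ => Complex.exp (-u) * (Complex.exp (-(s * (v - u))) - 1 + s * (v - u)))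
    (a := 0) (b := 1)
    (f' := fun s => Complex.exp (-u) * (-(v - u) * Complex.exp (-(s * (v - u))) + (v - u)))
    (B := fun s => s ^ 2 * ‖v - u‖ ^ 2 / 2) (B' := fun s => s * ‖v - u‖ ^ 2)
    (by fun_prop)
    (fun s _ => by
      have h3 : HasDerivAt (fun x : ℝ => (x : ℂ) * (v - u)) (v - u) s := by
        simpa using (Complex.ofRealCLM.hasDerivAt (x := s)).mul_const (v - u)
      exact ((((hasDerivAt_exp_neg_mul (v - u) s).sub_const 1).add h3).const_mul
        _).hasDerivWithinAt)
    (by simp)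
    (fun s => by
      refine (((hasDerivAt_pow 2 s).mul_const (‖v - u‖ ^ 2)).div_const 2).congr_deriv ?_
      push_cast; ring)
    (fun s hs => by
      have := h1 (Set.Ico_subset_Icc_self hs)
      calc _ = ‖v - u‖ * ‖Complex.exp (-u) * (Complex.exp (-(s * (v - u))) - 1)‖ := by
            rw [← norm_mul, ← norm_neg]; congr 1; ring
        _ ≤ ‖v - u‖ * (s * ‖v - u‖) := mul_le_mul_of_nonneg_left this (norm_nonneg _)
        _ = _ := by ring)
  have h3 := h2 (Set.right_mem_Icc.2 zero_le_one)
  have h4 : Complex.exp (-v) = Complex.exp (-u) * Complex.exp (-(v - u)) := by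
    rw [← Complex.exp_add]; congr 1; ring
  rw [h4]
  calc _ = ‖Complex.exp (-u) * (Complex.exp (-((1 : ℝ) * (v - u))) - 1 + (1 : ℝ) * (v - u))‖ := by
        congr 1; push_cast; ring_nf
    _ ≤ _ := by simpa using h3

/-! ### Comparison of powers and of the three kernels -/

/-- Second order comparison of the powers of two elements of norm at most `q`. -/
lemma norm_pow_sub_pow_sub_le {a b : ℂ} {q d : ℝ} (hq : 0 ≤ q) (ha : ‖a‖ ≤ q) (hb : ‖b‖ ≤ q)
    (hab : ‖a - b‖ ≤ d * q) (m : ℕ) :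
    ‖a ^ m - b ^ m - m * (a - b) * b ^ (m - 1)‖ ≤ m * (m - 1) / 2 * d ^ 2 * q ^ m := by
  induction m with
  | zero => simp
  | succ m ih =>
    -- The exponent `m - 1` truncates at 0, so the recursion `e` starts from exponent 1.
    rcases m with _ | m
    · simp
    have e : a ^ (m + 1 + 1) - b ^ (m + 1 + 1)
        - ((m + 1 + 1 : ℕ) : ℂ) * (a - b) * b ^ (m + 1 + 1 - 1)
        = a * (a ^ (m + 1) - b ^ (m + 1) - ((m + 1 : ℕ) : ℂ) * (a - b) * b ^ (m + 1 - 1))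
          + ((m + 1 : ℕ) : ℂ) * (a - b) ^ 2 * b ^ m := by
      simp only [Nat.add_sub_cancel]
      push_cast
      ring
    have h2 : ‖a - b‖ ^ 2 ≤ (d * q) ^ 2 := pow_le_pow_left₀ (norm_nonneg _) hab 2
    rw [e]
    calc _ ≤ q * (((m + 1 : ℕ) : ℝ) * (((m + 1 : ℕ) : ℝ) - 1) / 2 * d ^ 2 * q ^ (m + 1))
          + ((m + 1 : ℕ) : ℝ) * (d * q) ^ 2 * q ^ m := by
          refine (norm_add_le _ _).trans (add_le_add ?_ ?_)
          · rw [norm_mul]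
            exact mul_le_mul ha ih (norm_nonneg _) hq
          · rw [norm_mul, norm_mul, norm_pow, norm_pow, Complex.norm_natCast]
            gcongr
      _ = _ := by push_cast; ring

/-- Second order comparison of the powers `a ^ m + c ^ m - 2 * b ^ m`. -/
lemma norm_pow_add_pow_sub_two_mul_pow_le {a b c : ℂ} {q d e : ℝ} (hq : 0 ≤ q)
    (ha : ‖a‖ ≤ q) (hb : ‖b‖ ≤ q) (hc : ‖c‖ ≤ q) (hab : ‖a - b‖ ≤ d * q) (hcb : ‖c - b‖ ≤ d * q)
    (habc : ‖a + c - 2 * b‖ ≤ e * q) (m : ℕ) :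
    ‖a ^ m + c ^ m - 2 * b ^ m‖ ≤ (m * e + m * (m - 1) * d ^ 2) * q ^ m := by
  have h1 := norm_pow_sub_pow_sub_le hq ha hb hab m
  have h2 := norm_pow_sub_pow_sub_le hq hc hb hcb m
  have h3 : ‖m * (a + c - 2 * b) * b ^ (m - 1)‖ ≤ m * e * q ^ m := by
    rcases m with _ | m
    · simp
    · rw [norm_mul, norm_mul, norm_pow, Complex.norm_natCast, Nat.add_sub_cancel]
      have he : 0 ≤ e * q := (norm_nonneg _).trans habc
      calc _ ≤ ((m + 1 : ℕ) : ℝ) * (e * q) * q ^ m := by gcongr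
        _ = _ := by ring
  -- Linearise both powers at `b`: the first order terms merge into a multiple of `a + c - 2 * b`,
  -- which is smaller than either difference in the application.
  calc _ = ‖(a ^ m - b ^ m - m * (a - b) * b ^ (m - 1))
        + (c ^ m - b ^ m - m * (c - b) * b ^ (m - 1))
        + m * (a + c - 2 * b) * b ^ (m - 1)‖ := by congr 1; ring
    _ ≤ _ := norm_add₃_le
    _ ≤ _ := by linarith

/-- The three kernels `(1 + 2z)⁻¹`, `((1 + z)⁻¹)²` and `exp (-z)²` agree to second order. -/
lemma norm_kernel_pow_le {z : ℂ} (hz : 0 ≤ z.re) (hz1 : ‖z‖ ≤ 1) (m : ℕ) :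
    ‖((1 + 2 * z)⁻¹) ^ m + (Complex.exp (-z) ^ 2) ^ m - 2 * (((1 + z)⁻¹) ^ 2) ^ m‖
      ≤ (m * (35 / 12 * ‖z‖ ^ 3) + m * (m - 1) * ‖z‖ ^ 4) * ((1 + 2 * z.re)⁻¹) ^ m := by
  set Y := z.re with hY
  set q := (1 + 2 * Y)⁻¹ with hq
  have hq0 : 0 ≤ q := by positivity
  have hq1 : q ≤ 1 := inv_le_one_of_one_le₀ (by linarith)
  set E := (1 + z)⁻¹ with hE
  set A := (1 + 2 * z)⁻¹ with hA
  set D := Complex.exp (-z) with hD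
  have hE1 : (1 + Y : ℝ) ≤ ‖1 + z‖ := by
    refine le_trans ?_ (Complex.re_le_norm _); simp [hY]
  have hA1 : (1 + 2 * Y : ℝ) ≤ ‖1 + 2 * z‖ := by
    refine le_trans ?_ (Complex.re_le_norm _); simp [hY]
  have hE0 : 1 + z ≠ 0 := norm_pos_iff.1 (by linarith)
  have hA0 : 1 + 2 * z ≠ 0 := norm_pos_iff.1 (by linarith)
  -- All three kernels are dominated by the same `q`, because `(1 + Y) ^ 2` and `exp (2 * Y)` are
  -- both at least `1 + 2 * Y`.
  have hAq : ‖A‖ ≤ q := by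
    rw [hA, norm_inv]; exact inv_anti₀ (by positivity) hA1
  have hEq : ‖E‖ ^ 2 ≤ q := by
    rw [hE, norm_inv, inv_pow]
    refine inv_anti₀ (by positivity) ?_
    nlinarith [pow_le_pow_left₀ (by positivity) hE1 2]
  have hDq : ‖D‖ ^ 2 ≤ q := by
    rw [hD, Complex.norm_exp, ← Real.exp_nat_mul, hq]
    rw [show ((2 : ℕ) : ℝ) * (-z).re = -(2 * Y) by simp [hY], Real.exp_neg]
    exact inv_anti₀ (by positivity) (by linarith [Real.add_one_le_exp (2 * Y)])
  have hA' : ‖A‖ ≤ 1 := hAq.trans hq1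
  have hDE : ‖D‖ * ‖E‖ ≤ q := by nlinarith [sq_nonneg (‖D‖ - ‖E‖)]
  have e1 : A - E ^ 2 = z ^ 2 * A * E ^ 2 := by
    rw [hA, hE]; field_simp; ring
  have e2 : D - E = E * ((1 + z) * D - 1) := by
    rw [hE]; field_simp
  have hDmE : ‖D - E‖ ≤ ‖E‖ * (‖z‖ ^ 2 / 2) := by
    rw [e2, norm_mul]
    exact mul_le_mul_of_nonneg_left (norm_one_add_mul_exp_neg_sub_one_le hz) (norm_nonneg _)
  have hEDpE : ‖E‖ * ‖D + E‖ ≤ 2 * q := by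
    calc _ ≤ ‖E‖ * (‖D‖ + ‖E‖) := by gcongr; exact norm_add_le _ _
      _ ≤ 2 * q := by nlinarith
  refine (norm_pow_add_pow_sub_two_mul_pow_le (d := ‖z‖ ^ 2) (e := 35 / 12 * ‖z‖ ^ 3) hq0 hAq
    ?_ ?_ ?_ ?_ ?_ m).trans (le_of_eq (by ring))
  · rwa [norm_pow]
  · rwa [norm_pow]
  · rw [e1, norm_mul, norm_mul, norm_pow, norm_pow]
    calc ‖z‖ ^ 2 * ‖A‖ * ‖E‖ ^ 2 ≤ ‖z‖ ^ 2 * 1 * q := by gcongr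
      _ = _ := by ring
  · have : D ^ 2 - E ^ 2 = (D - E) * (D + E) := by ring
    rw [this, norm_mul]
    calc _ ≤ ‖E‖ * (‖z‖ ^ 2 / 2) * ‖D + E‖ := by gcongr
      _ = ‖z‖ ^ 2 / 2 * (‖E‖ * ‖D + E‖) := by ring
      _ ≤ ‖z‖ ^ 2 / 2 * (2 * q) := by gcongr
      _ = _ := by ring
  -- To leading order `A - E ^ 2` is `z ^ 2` and `D ^ 2 - E ^ 2` is `-z ^ 2`. After this
  -- cancellation the three cubic remainders cost `2 + 1 / 4 + 2 / 3 = 35 / 12`.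
  · have e3 : A + D ^ 2 - 2 * E ^ 2 = -2 * z ^ 3 * A * E ^ 2
        + -(z ^ 2 / 2 * (E * (D - E)))
        + ((1 + z) * D - 1 + z ^ 2 / 2) * (E * (D + E)) := by
      have e4 : A = 1 - 2 * z * A := by rw [hA]; field_simp; ring
      have e5 : E * (1 + z) = 1 := by rw [hE]; field_simp
      have e6 : D ^ 2 - E ^ 2 = ((1 + z) * D - 1) * (E * (D + E)) := by
        have : D = E * (1 + z) * D := by rw [e5, one_mul]
        linear_combination (D + E) * e2
      linear_combination e1 + e6 + z ^ 2 * E ^ 2 * e4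
    have t1 : ‖-2 * z ^ 3 * A * E ^ 2‖ ≤ 2 * ‖z‖ ^ 3 * q := by
      simp only [norm_mul, norm_pow, norm_neg, Complex.norm_ofNat]
      calc 2 * ‖z‖ ^ 3 * ‖A‖ * ‖E‖ ^ 2 ≤ 2 * ‖z‖ ^ 3 * 1 * q := by gcongr
        _ = _ := by ring
    have t2 : ‖-(z ^ 2 / 2 * (E * (D - E)))‖ ≤ 1 / 4 * ‖z‖ ^ 3 * q := by
      simp only [norm_mul, norm_div, norm_pow, norm_neg, Complex.norm_ofNat]
      calc ‖z‖ ^ 2 / 2 * (‖E‖ * ‖D - E‖) ≤ ‖z‖ ^ 2 / 2 * (‖E‖ * (‖E‖ * (‖z‖ ^ 2 / 2))) := by gcongr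
        _ = 1 / 4 * (‖z‖ ^ 3 * ‖z‖) * ‖E‖ ^ 2 := by ring
        _ ≤ 1 / 4 * (‖z‖ ^ 3 * 1) * q := by gcongr
        _ = _ := by ring
    have t3 : ‖((1 + z) * D - 1 + z ^ 2 / 2) * (E * (D + E))‖ ≤ 2 / 3 * ‖z‖ ^ 3 * q := by
      rw [norm_mul, norm_mul]
      calc _ ≤ ‖z‖ ^ 3 / 3 * (2 * q) := by
            gcongr
            exact norm_one_add_mul_exp_neg_sub_one_add_le hz
        _ = _ := by ring
    rw [e3]
    refine norm_add₃_le.trans ?_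
    linarith

/-! ### The curve `1 - exp (iφ)` and the majorant of the error symbol -/

/-- The point `1 - exp (i φ)`. -/
noncomputable def circGap (φ : ℝ) : ℂ := 1 - Complex.exp (Complex.I * φ)

@[fun_prop] lemma continuous_circGap : Continuous circGap := by
  unfold circGap; fun_prop

lemma circGap_re (φ : ℝ) : (circGap φ).re = 1 - Real.cos φ := by
  simp [circGap, mul_comm Complex.I, Complex.exp_ofReal_mul_I_re]

lemma circGap_im (φ : ℝ) : (circGap φ).im = -Real.sin φ := by
  simp [circGap, mul_comm Complex.I, Complex.exp_ofReal_mul_I_im]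

lemma circGap_re_nonneg (φ : ℝ) : 0 ≤ (circGap φ).re := by
  rw [circGap_re]; linarith [Real.cos_le_one φ]

/-- The circle of radius 1 about 1 passes through 0. This identity lets decay in the real part
control powers of the norm. -/
lemma norm_circGap_sq (φ : ℝ) : ‖circGap φ‖ ^ 2 = 2 * (circGap φ).re := by
  rw [Complex.sq_norm, Complex.normSq_apply, circGap_re, circGap_im]
  linear_combination Real.sin_sq_add_cos_sq φ

lemma norm_circGap_le_two (φ : ℝ) : ‖circGap φ‖ ≤ 2 := by
  have h := norm_circGap_sq φ
  rw [circGap_re] at h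
  nlinarith [Real.neg_one_le_cos φ, norm_nonneg (circGap φ)]

lemma norm_circGap_le_abs (φ : ℝ) : ‖circGap φ‖ ≤ |φ| := by
  refine abs_le_of_sq_le_sq' ?_ (abs_nonneg _) |>.2
  rw [norm_circGap_sq, circGap_re, sq_abs]
  linarith [Real.one_sub_sq_div_two_le_cos (x := φ)]

lemma mul_sq_le_norm_circGap_sq {φ : ℝ} (hφ : |φ| ≤ Real.pi) :
    4 / Real.pi ^ 2 * φ ^ 2 ≤ ‖circGap φ‖ ^ 2 := by
  rw [norm_circGap_sq, circGap_re]
  have := Real.cos_le_one_sub_mul_cos_sq hφ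
  have e : 4 / Real.pi ^ 2 * φ ^ 2 = 2 * (2 / Real.pi ^ 2 * φ ^ 2) := by ring
  linarith

lemma circGap_ne_zero {φ : ℝ} (h0 : φ ≠ 0) (hφ : |φ| ≤ Real.pi) : circGap φ ≠ 0 := by
  intro h
  have := mul_sq_le_norm_circGap_sq hφ
  rw [h] at this
  have : 0 < 4 / Real.pi ^ 2 * φ ^ 2 := by positivity
  simp_all
  linarith

/-- The primitive `u ^ 4 / (4 * (1 + b * u ^ 2) ^ 2)` of `u ^ 3 / (1 + b * u ^ 2) ^ 3`. -/
lemma integral_cube_div_le {b : ℝ} (hb : 0 < b) (R : ℝ) :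
    ∫ u in (0 : ℝ)..R, u ^ 3 / (1 + b * u ^ 2) ^ 3 ≤ 1 / (4 * b ^ 2) := by
  have hpos : ∀ u : ℝ, 0 < 1 + b * u ^ 2 := fun u => by positivity
  have hd : ∀ u : ℝ, HasDerivAt (fun u : ℝ => u ^ 4 / (4 * (1 + b * u ^ 2) ^ 2))
      (u ^ 3 / (1 + b * u ^ 2) ^ 3) u := by
    intro u
    have h1 : HasDerivAt (fun u : ℝ => 1 + b * u ^ 2) (b * (2 * u)) u := by
      simpa using ((hasDerivAt_pow 2 u).const_mul b).const_add 1
    have h2 := (hasDerivAt_pow 4 u).div ((h1.pow 2).const_mul 4)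
      (mul_pos four_pos (pow_pos (hpos u) 2)).ne'
    refine h2.congr_deriv ?_
    have := (hpos u).ne'
    simp only [Pi.pow_apply]
    field_simp
    push_cast
    ring
  rw [intervalIntegral.integral_eq_sub_of_hasDerivAt (fun u _ => hd u)]
  · have := hpos R
    simp only [ne_eq, OfNat.ofNat_ne_zero, not_false_eq_true, zero_pow, zero_div, sub_zero]
    rw [div_le_div_iff₀ (by positivity) (by positivity)]
    nlinarith [mul_nonneg hb.le (sq_nonneg R), pow_nonneg (mul_nonneg hb.le (sq_nonneg R)) 2]
  · refine Continuous.intervalIntegrable ?_ _ _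
    exact (by fun_prop : Continuous fun u : ℝ => u ^ 3).div (by fun_prop)
      fun u => (pow_pos (hpos u) 3).ne'

lemma integral_neg_pi_pi_abs {f : ℝ → ℝ} (hf : Continuous f) :
    ∫ u in -Real.pi..Real.pi, f |u| = 2 * ∫ u in (0 : ℝ)..Real.pi, f u := by
  have hc : Continuous fun u => f |u| := hf.comp continuous_abs
  rw [← intervalIntegral.integral_add_adjacent_intervals (b := 0)
    (hc.intervalIntegrable _ _) (hc.intervalIntegrable _ _)]
  have h1 : ∫ u in -Real.pi..0, f |u| = ∫ u in (0 : ℝ)..Real.pi, f |u| := by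
    have := intervalIntegral.integral_comp_neg (a := 0) (b := Real.pi) (fun u => f |u|)
    simp only [abs_neg, neg_zero] at this
    exact this.symm
  have h2 : ∫ u in (0 : ℝ)..Real.pi, f |u| = ∫ u in (0 : ℝ)..Real.pi, f u := by
    refine intervalIntegral.integral_congr fun u hu => ?_
    rw [Set.uIcc_of_le Real.pi_pos.le] at hu
    simp only [abs_of_nonneg hu.1]
  rw [h1, h2]; ring

lemma integral_abs_neg_pi_pi : ∫ u in -Real.pi..Real.pi, |u| = Real.pi ^ 2 := by
  rw [integral_neg_pi_pi_abs (f := fun u => u) continuous_id, integral_id]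
  ring

/-- Pointwise bound of the Fourier symbol of the accelerated operator, with a majorant of mean at
most `9 * π ^ 3 / 256`. -/
lemma exists_majorant_kernel_pow {ρ : ℝ} (h0 : 0 < ρ) (h1 : ρ ≤ 1) (m : ℕ) :
    ∃ h : ℝ → ℝ, Continuous h ∧
      ∫ φ in -Real.pi..Real.pi, h φ ≤ 2 * Real.pi * (9 * Real.pi ^ 3 / 256) ∧
      ∀ φ : ℝ, |φ| ≤ Real.pi →
        ‖(((1 + ρ * circGap φ)⁻¹) ^ m + (Complex.exp (-(ρ * circGap φ))) ^ m
          - 2 * (((1 + ρ / 2 * circGap φ)⁻¹) ^ 2) ^ m) / circGap φ‖ ≤ ρ ^ 2 * (35 / 48 + h φ) := by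
  have hπ := Real.pi_pos
  have key : ∀ φ : ℝ,
        ‖(((1 + ρ * circGap φ)⁻¹) ^ m + (Complex.exp (-(ρ * circGap φ))) ^ m
          - 2 * (((1 + ρ / 2 * circGap φ)⁻¹) ^ 2) ^ m) / circGap φ‖ ≤
          ρ ^ 2 * (35 / 48 + m * (m - 1) * ρ ^ 2 * ‖circGap φ‖ ^ 3 / 16
            * ((1 + ρ * ‖circGap φ‖ ^ 2 / 2)⁻¹) ^ m) := by
    intro φ
    set N := ‖circGap φ‖ with hN
    have hN0 : 0 ≤ N := norm_nonneg _
    have hN2 : N ≤ 2 := norm_circGap_le_two φ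
    have hm0 : (0 : ℝ) ≤ m * (m - 1) := by
      rcases m with _ | m
      · simp
      · push_cast; rw [add_sub_cancel_right]; positivity
    by_cases hθ : circGap φ = 0
    · rw [hθ, div_zero, norm_zero]; positivity
    have hNpos : 0 < N := norm_pos_iff.2 hθ
    have hnz : ‖(ρ / 2 : ℂ) * circGap φ‖ = ρ * N / 2 := by
      rw [norm_mul, norm_div, Complex.norm_real, Real.norm_of_nonneg h0.le, Complex.norm_ofNat]
      ring
    have hre : ((ρ / 2 : ℂ) * circGap φ).re = ρ * N ^ 2 / 4 := by
      rw [hN, norm_circGap_sq]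
      have : (ρ / 2 : ℂ) = ((ρ / 2 : ℝ) : ℂ) := by push_cast; rfl
      rw [this, Complex.re_ofReal_mul]; ring
    have h := norm_kernel_pow_le (z := ρ / 2 * circGap φ) (by rw [hre]; positivity)
      (by rw [hnz]; nlinarith) m
    rw [hnz, hre] at h
    have e1 : 1 + 2 * ((ρ / 2 : ℂ) * circGap φ) = 1 + ρ * circGap φ := by ring
    have e2 : Complex.exp (-((ρ / 2 : ℂ) * circGap φ)) ^ 2 = Complex.exp (-(ρ * circGap φ)) := by
      rw [← Complex.exp_nat_mul]; congr 1; push_cast; ring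
    have e3 : 1 + 2 * (ρ * N ^ 2 / 4) = 1 + ρ * N ^ 2 / 2 := by ring
    rw [e1, e2, e3] at h
    -- Bernoulli: the decaying power absorbs the factor `m` of the cubic term, leaving the constant
    -- `35 / 48`.
    have hb : m * (ρ * N ^ 2 / 2) * ((1 + ρ * N ^ 2 / 2)⁻¹) ^ m ≤ 1 := by
      have h3 := one_add_mul_le_pow (a := ρ * N ^ 2 / 2) (by
        have : 0 ≤ ρ * N ^ 2 / 2 := by positivity
        linarith) m
      rw [inv_pow, ← div_eq_mul_inv, div_le_one (by positivity)]
      linarith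
    rw [norm_div, div_le_iff₀ hNpos]
    refine h.trans ?_
    have e : ((m : ℝ) * (35 / 12 * (ρ * N / 2) ^ 3) + m * (m - 1) * (ρ * N / 2) ^ 4)
        * ((1 + ρ * N ^ 2 / 2)⁻¹) ^ m
        = ρ ^ 2 * (35 / 48 * (m * (ρ * N ^ 2 / 2) * ((1 + ρ * N ^ 2 / 2)⁻¹) ^ m)
          + m * (m - 1) * ρ ^ 2 * N ^ 3 / 16 * ((1 + ρ * N ^ 2 / 2)⁻¹) ^ m) * N := by ring
    rw [e]
    gcongr
    linarith
  -- Extracting a cube from the `m`-th power needs `m / 3 ≥ 1`. For `m ≤ 2` the constant majorant 1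
  -- works, since `9 * π ^ 3 / 256 > 1`.
  rcases le_or_gt m 2 with hm | hm
  · refine ⟨fun _ => 1, continuous_const, ?_, fun φ _ => (key φ).trans ?_⟩
    · rw [intervalIntegral.integral_const, smul_eq_mul, mul_one]
      have h3 : (3.1 : ℝ) ^ 3 ≤ Real.pi ^ 3 :=
        pow_le_pow_left₀ (by norm_num) (by linarith [Real.pi_gt_d2]) 3
      nlinarith
    · set N := ‖circGap φ‖ with hN
      have hN0 : 0 ≤ N := norm_nonneg _
      have hN2 : N ≤ 2 := norm_circGap_le_two φ
      have hN3 : N ^ 3 ≤ 2 ^ 3 := pow_le_pow_left₀ hN0 hN2 3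
      have hm2 : (m : ℝ) * (m - 1) ≤ 2 := by interval_cases m <;> norm_num
      have hm0 : (0 : ℝ) ≤ m * (m - 1) := by interval_cases m <;> norm_num
      have hq : ((1 + ρ * N ^ 2 / 2)⁻¹) ^ m ≤ 1 :=
        pow_le_one₀ (by positivity) (inv_le_one_of_one_le₀ (by
          have : 0 ≤ ρ * N ^ 2 / 2 := by positivity
          linarith))
      have hρ : ρ ^ 2 ≤ 1 := pow_le_one₀ h0.le h1
      gcongr
      calc _ ≤ (2 : ℝ) * 1 * 2 ^ 3 / 16 * 1 := by gcongr
        _ = 1 := by norm_num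
  · set x : ℝ := m * ρ with hx
    have hm0 : (0 : ℝ) < m := by exact_mod_cast (by omega : 0 < m)
    have hm3 : (3 : ℝ) ≤ m := by exact_mod_cast hm
    have hx0 : 0 < x := by positivity
    -- Bernoulli with exponent `m / 3` and `N ^ 2 ≥ 4 φ ^ 2 / π ^ 2` give the base `1 + b φ ^ 2`. As
    -- `b` is proportional to `x`, the integral bound `x ^ 2 / (32 * b ^ 2)` does not depend on `x`.
    -- A square in place of the cube would give a logarithm of `x`.
    set b : ℝ := 2 * x / (3 * Real.pi ^ 2) with hb
    have hb0 : 0 < b := by positivity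
    have hc : Continuous fun u : ℝ => x ^ 2 / 16 * (u ^ 3 / (1 + b * u ^ 2) ^ 3) :=
      continuous_const.mul ((by fun_prop : Continuous fun u : ℝ => u ^ 3).div (by fun_prop)
        fun u => (by positivity : (0 : ℝ) < (1 + b * u ^ 2) ^ 3).ne')
    refine ⟨fun φ => x ^ 2 / 16 * (|φ| ^ 3 / (1 + b * |φ| ^ 2) ^ 3), hc.comp continuous_abs, ?_,
      fun φ hφ => (key φ).trans ?_⟩
    · rw [integral_neg_pi_pi_abs hc, intervalIntegral.integral_const_mul]
      calc _ ≤ 2 * (x ^ 2 / 16 * (1 / (4 * b ^ 2))) := by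
            gcongr; exact integral_cube_div_le hb0 _
        _ = _ := by rw [hb]; field_simp; norm_num
    · set N := ‖circGap φ‖ with hN
      have hN0 : 0 ≤ N := norm_nonneg _
      have hNφ : N ≤ |φ| := norm_circGap_le_abs φ
      have hy : 0 ≤ ρ * N ^ 2 / 2 := by positivity
      have h3 : (1 + b * |φ| ^ 2) ^ 3 ≤ (1 + ρ * N ^ 2 / 2) ^ m := by
        have h4 := one_add_mul_self_le_rpow_one_add (s := ρ * N ^ 2 / 2) (by linarith)
          (p := (m : ℝ) / 3) (by linarith)
        have h5 : b * |φ| ^ 2 ≤ m / 3 * (ρ * N ^ 2 / 2) := by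
          have := mul_sq_le_norm_circGap_sq hφ
          rw [sq_abs]
          calc b * φ ^ 2 = x / 6 * (4 / Real.pi ^ 2 * φ ^ 2) := by rw [hb]; field_simp; ring
            _ ≤ x / 6 * N ^ 2 := by gcongr
            _ = _ := by rw [hx]; ring
        calc _ ≤ ((1 + ρ * N ^ 2 / 2) ^ ((m : ℝ) / 3)) ^ 3 := by
              gcongr; linarith
          _ = _ := by
              rw [← Real.rpow_natCast _ 3, ← Real.rpow_mul (by positivity), ← Real.rpow_natCast _ m]
              norm_num
      gcongr ρ ^ 2 * (35 / 48 + ?_)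
      calc _ ≤ x ^ 2 * |φ| ^ 3 / 16 * ((1 + b * |φ| ^ 2) ^ 3)⁻¹ := by
            rw [inv_pow]
            have : (m : ℝ) * (m - 1) * ρ ^ 2 ≤ x ^ 2 := by
              rw [hx, mul_pow, sq (m : ℝ)]; gcongr; linarith
            gcongr
        _ = _ := by ring

/-! ### Fourier representation of the Erlang distribution function -/

lemma integral_exp_int_mul (n k : ℕ) :
    ∫ φ in -Real.pi..Real.pi, Complex.exp (((n : ℂ) - k) * Complex.I * φ)
      = if n = k then (2 * Real.pi : ℂ) else 0 := by
  split_ifs with h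
  · subst h
    simp only [sub_self, zero_mul, Complex.exp_zero, intervalIntegral.integral_const]
    simp; ring
  · have hc : ((n : ℂ) - k) * Complex.I ≠ 0 :=
      mul_ne_zero (sub_ne_zero.2 (by exact_mod_cast h)) Complex.I_ne_zero
    rw [integral_exp_mul_complex hc, div_eq_zero_iff]
    left
    rw [sub_eq_zero, Complex.exp_eq_exp_iff_exists_int]
    exact ⟨(n : ℤ) - k, by push_cast; ring⟩

/-- The Poisson weights as Fourier coefficients. -/
lemma integral_fourier_exp_neg_mul_circGap (k : ℕ) (σ : ℝ) :
    ∫ φ in -Real.pi..Real.pi, Complex.exp (-(k * Complex.I * φ)) * Complex.exp (-(σ * circGap φ))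
      = 2 * Real.pi * (σ ^ k * Real.exp (-σ) / k.factorial : ℝ) := by
  -- Expand `exp (σ exp (iφ))` in its power series and integrate termwise; orthogonality keeps only
  -- `n = k`.
  have key : HasSum (fun n : ℕ => ∫ φ in -Real.pi..Real.pi,
      (Complex.exp (-σ) * (σ ^ n / n.factorial)) * Complex.exp (((n : ℂ) - k) * Complex.I * φ))
      (∫ φ in -Real.pi..Real.pi,
        Complex.exp (-(k * Complex.I * φ)) * Complex.exp (-(σ * circGap φ))) := by
    refine intervalIntegral.hasSum_integral_of_dominated_convergence
      (fun n _ => Real.exp (-σ) * (|σ| ^ n / n.factorial)) (fun n => ?_) (fun n => ?_) ?_ ?_ ?_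
    · exact (by fun_prop : Continuous _).aestronglyMeasurable
    · refine .of_forall fun φ _ => le_of_eq ?_
      have e : ((n : ℂ) - k) * Complex.I * φ = (((n : ℝ) - k) * φ : ℝ) * Complex.I := by
        push_cast; ring
      rw [norm_mul, e, Complex.norm_exp_ofReal_mul_I, mul_one, norm_mul, norm_div, norm_pow,
        Complex.norm_real, Real.norm_eq_abs, Complex.norm_natCast, ← Complex.ofReal_neg,
        Complex.norm_exp_ofReal]
    · exact .of_forall fun φ _ => (Real.summable_pow_div_factorial |σ|).mul_left _
    · exact intervalIntegrable_const
    · refine .of_forall fun φ _ => ?_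
      have h := (NormedSpace.expSeries_div_hasSum_exp (𝔸 := ℂ)
        (σ * Complex.exp (Complex.I * φ))).mul_left
        (Complex.exp (-σ) * Complex.exp (-(k * Complex.I * φ)))
      rw [← Complex.exp_eq_exp_ℂ] at h
      have e : Complex.exp (-σ) * Complex.exp (-(k * Complex.I * φ))
          * Complex.exp (σ * Complex.exp (Complex.I * φ))
          = Complex.exp (-(k * Complex.I * φ)) * Complex.exp (-(σ * circGap φ)) := by
        simp only [← Complex.exp_add, circGap]; congr 1; ring
      rw [e] at h
      have e3 : ∀ n : ℕ, Complex.exp (-σ) * (σ ^ n / n.factorial)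
          * Complex.exp (((n : ℂ) - k) * Complex.I * φ)
          = Complex.exp (-σ) * Complex.exp (-(k * Complex.I * φ))
            * ((σ * Complex.exp (Complex.I * φ)) ^ n / n.factorial) := by
        intro n
        have e2 : ((n : ℂ) - k) * Complex.I * φ = -(k * Complex.I * φ) + n * (Complex.I * φ) := by
          ring
        rw [mul_pow, ← Complex.exp_nat_mul, e2, Complex.exp_add]
        ring
      simpa only [e3] using h
  have h2 := key.unique (hasSum_single k fun n hn => by
    rw [intervalIntegral.integral_const_mul, integral_exp_int_mul, if_neg hn, mul_zero])
  rw [h2, intervalIntegral.integral_const_mul, integral_exp_int_mul, if_pos rfl]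
  push_cast
  ring

lemma erlangCDF_eq_intervalIntegral {a : ℝ} (ha : 0 < a) (j : ℕ+) {x : ℝ} (hx : 0 ≤ x) :
    erlangCDF a j x = ∫ y in (0 : ℝ)..x,
      a * ((a * y) ^ j.natPred * Real.exp (-(a * y)) / j.natPred.factorial) := by
  have hj : (0 : ℝ) < (j : ℕ) := by exact_mod_cast j.pos
  have hk : ((j : ℕ) : ℝ) = j.natPred + 1 := by
    rw [← PNat.natPred_add_one]; push_cast; simp
  rw [erlangCDF, cdf_gammaMeasure_eq_integral hj ha,
    setIntegral_eq_of_subset_of_forall_sdiff_eq_zero measurableSet_Iic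
      (Set.Icc_subset_Iic_self : Set.Icc 0 x ⊆ Set.Iic x), integral_Icc_eq_integral_Ioc,
    intervalIntegral.integral_of_le hx]
  · refine setIntegral_congr_fun measurableSet_Ioc fun y hy => ?_
    simp only [gammaPDFReal, if_pos hy.1.le]
    rw [hk, Real.Gamma_nat_eq_factorial, add_sub_cancel_right, Real.rpow_natCast,
      Real.rpow_add_one ha.ne', Real.rpow_natCast]
    ring
  · intro y hy
    have : y < 0 := by
      by_contra h
      exact hy.2 ⟨not_lt.1 h, hy.1⟩
    simp [gammaPDFReal, not_le.2 this]

/-- The Fourier mean `(2π)⁻¹ ∫ e^{-ikφ} Φ(θ(φ)) / θ(φ) dφ`, where `θ(φ) = 1 - e^{iφ}`. -/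
noncomputable def symbolMean (k : ℕ) (Φ : ℂ → ℂ) : ℂ :=
  (2 * Real.pi)⁻¹ * ∫ φ in -Real.pi..Real.pi,
    Complex.exp (-(k * Complex.I * φ)) * (Φ (circGap φ) / circGap φ)

lemma norm_exp_neg_nat_mul_I (k : ℕ) (φ : ℝ) : ‖Complex.exp (-(k * Complex.I * φ))‖ = 1 := by
  have : -((k : ℂ) * Complex.I * φ) = (-(k * φ) : ℝ) * Complex.I := by push_cast; ring
  rw [this, Complex.norm_exp_ofReal_mul_I]

lemma ae_circGap_ne_zero : ∀ᵐ φ : ℝ, φ ∈ Set.Ioc (-Real.pi) Real.pi → circGap φ ≠ 0 := by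
  filter_upwards [Measure.ae_ne volume (0 : ℝ)] with φ h hφ
  exact circGap_ne_zero h (abs_le.2 ⟨hφ.1.le, hφ.2⟩)

/-- Write the density by its Fourier formula, swap the integrals, and use that `a exp (-ayθ)`
integrates over `[0, x]` to `(1 - exp (-axθ)) / θ`. The zero of `θ` at `φ = 0` is a null set. -/
lemma erlangCDF_eq_symbolMean {a : ℝ} (ha : 0 < a) (j : ℕ+) {x : ℝ} (hx : 0 ≤ x) :
    (erlangCDF a j x : ℂ) = symbolMean j.natPred (fun w => 1 - Complex.exp (-(a * x * w))) := by
  set k := j.natPred with hk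
  have hπ : (Real.pi : ℂ) ≠ 0 := by exact_mod_cast Real.pi_ne_zero
  have hπ' : -Real.pi ≤ Real.pi := by linarith [Real.pi_pos]
  have h1 : ∀ y : ℝ, ((a * ((a * y) ^ k * Real.exp (-(a * y)) / k.factorial) : ℝ) : ℂ)
      = (2 * Real.pi)⁻¹ * ∫ φ in -Real.pi..Real.pi, a * (Complex.exp (-(k * Complex.I * φ))
        * Complex.exp (-((a * y : ℝ) * circGap φ))) := by
    intro y
    rw [intervalIntegral.integral_const_mul, integral_fourier_exp_neg_mul_circGap k (a * y)]
    push_cast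
    field_simp
  rw [erlangCDF_eq_intervalIntegral ha j hx]
  refine (intervalIntegral.integral_ofReal.symm.trans
    (intervalIntegral.integral_congr fun y _ => h1 y)).trans ?_
  rw [intervalIntegral.integral_const_mul, symbolMean,
    intervalIntegral_intervalIntegral_swap]
  · congr 1
    refine intervalIntegral.integral_congr_ae ?_
    rw [Set.uIoc_of_le hπ']
    filter_upwards [ae_circGap_ne_zero] with φ h hφ
    have hc : -(a * circGap φ) ≠ 0 :=
      neg_ne_zero.2 (mul_ne_zero (by exact_mod_cast ha.ne') (h hφ))
    have e : ∀ y : ℝ, (a : ℂ) * (Complex.exp (-(k * Complex.I * φ))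
        * Complex.exp (-((a * y : ℝ) * circGap φ)))
        = a * Complex.exp (-(k * Complex.I * φ)) * Complex.exp (-(a * circGap φ) * y) := by
      intro y
      rw [show -(((a * y : ℝ) : ℂ) * circGap φ) = -(a * circGap φ) * y by push_cast; ring]
      ring
    simp_rw [e]
    rw [intervalIntegral.integral_const_mul, integral_exp_mul_complex hc]
    have h2 := h hφ
    have ha' : (a : ℂ) ≠ 0 := by exact_mod_cast ha.ne'
    have e2 : -(a * circGap φ) * x = -(a * x * circGap φ) := by ring
    rw [e2]
    simp only [Complex.ofReal_zero, mul_zero, Complex.exp_zero]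
    field_simp
    ring
  · refine IntegrableOn.mono_set (t := Set.uIcc 0 x ×ˢ Set.uIcc (-Real.pi) Real.pi) ?_
      (Set.prod_mono Set.uIoc_subset_uIcc Set.uIoc_subset_uIcc)
    refine ContinuousOn.integrableOn_compact (isCompact_uIcc.prod isCompact_uIcc) ?_
    refine Continuous.continuousOn ?_
    simp only [Function.uncurry_def]
    fun_prop

/-! ### Gamma laws, their Laplace transform, and the symbol of `L_t` -/

lemma measurable_gammaPDF (u r : ℝ) : Measurable (gammaPDF u r) :=
  (measurable_gammaPDFReal u r).ennreal_ofReal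

lemma isProbabilityMeasure_gammaProcessLaw {u : ℝ} (hu : 0 ≤ u) :
    IsProbabilityMeasure (gammaProcessLaw u) := by
  unfold gammaProcessLaw
  split_ifs with h
  · infer_instance
  · exact isProbabilityMeasure_gammaMeasure (lt_of_le_of_ne hu (Ne.symm h)) one_pos

lemma ae_nonneg_gammaProcessLaw (u : ℝ) : ∀ᵐ s ∂gammaProcessLaw u, 0 ≤ s := by
  unfold gammaProcessLaw
  split_ifs with h
  · rw [ae_dirac_iff measurableSet_Ici]
  · rw [gammaMeasure, ae_withDensity_iff (measurable_gammaPDF _ _)]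
    refine .of_forall fun s hs => ?_
    by_contra hn
    exact hs (gammaPDF_of_neg (not_le.1 hn))

lemma gammaPDFReal_succ_one (n : ℕ) {s : ℝ} (hs : 0 ≤ s) :
    gammaPDFReal (n + 1 : ℕ) 1 s = s ^ n * Real.exp (-s) / n.factorial := by
  rw [gammaPDFReal, if_pos hs]
  push_cast
  rw [Real.Gamma_nat_eq_factorial, add_sub_cancel_right, Real.rpow_natCast, Real.one_rpow, one_mul]
  ring

lemma integral_gammaMeasure_nat (n : ℕ) (g : ℝ → ℂ) :
    ∫ s, g s ∂gammaMeasure (n + 1 : ℕ) 1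
      = ∫ s in Set.Ioi (0 : ℝ), ((s ^ n * Real.exp (-s) / n.factorial : ℝ) : ℂ) * g s := by
  rw [gammaMeasure, integral_withDensity_eq_integral_toReal_smul (measurable_gammaPDF _ _)
    (.of_forall fun s => ENNReal.ofReal_lt_top), ← integral_Ici_eq_integral_Ioi,
    ← setIntegral_eq_integral_of_forall_compl_eq_zero (s := Set.Ici (0 : ℝ))]
  · refine setIntegral_congr_fun measurableSet_Ici fun s hs => ?_
    have hs' : (0 : ℝ) ≤ s := hs
    simp only [gammaPDF]
    rw [ENNReal.toReal_ofReal (gammaPDFReal_nonneg (by positivity) one_pos s),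
      gammaPDFReal_succ_one n hs', Complex.real_smul]
  · intro s hs
    rw [gammaPDF_of_neg (not_le.1 hs)]
    simp

lemma integrableOn_pow_mul_exp_neg (n : ℕ) :
    IntegrableOn (fun s : ℝ => s ^ n * Real.exp (-s)) (Set.Ioi 0) := by
  have := Real.GammaIntegral_convergent (s := n + 1) (by positivity)
  refine this.congr_fun (fun s _ => ?_) measurableSet_Ioi
  simp only [add_sub_cancel_right, Real.rpow_natCast]
  ring

/-- The first moment supplies the dominating function for Fubini: `‖1 - exp (-sρθ)‖ / ‖θ‖ ≤ ρ s`. -/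
lemma integrable_id_gammaProcessLaw (m : ℕ) :
    Integrable (fun s : ℝ => s) (gammaProcessLaw m) := by
  rcases m with _ | n
  · rw [gammaProcessLaw, if_pos (by simp)]
    exact integrable_dirac (by simp)
  · rw [gammaProcessLaw, if_neg (by positivity), gammaMeasure,
      integrable_withDensity_iff_integrable_smul' (measurable_gammaPDF _ _)
      (.of_forall fun s => ENNReal.ofReal_lt_top)]
    rw [← integrableOn_iff_integrable_of_support_subset (s := Set.Ioi (0 : ℝ))]
    · refine IntegrableOn.congr_fun
        ((integrableOn_pow_mul_exp_neg (n + 1)).div_const (n.factorial : ℝ)) (fun s hs => ?_) measurableSet_Ioi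
      have hs' : (0 : ℝ) ≤ s := le_of_lt hs
      simp only [gammaPDF]
      rw [ENNReal.toReal_ofReal (gammaPDFReal_nonneg (by positivity) one_pos s),
        gammaPDFReal_succ_one n hs', smul_eq_mul]
      ring
    · intro s hs
      by_contra hn
      rcases eq_or_lt_of_le (not_lt.1 (show ¬ (0 : ℝ) < s from hn)) with h | h
      · exact hs (by simp [h])
      · exact hs (by simp [gammaPDF_of_neg h])

lemma norm_pow_mul_exp_neg_le (n : ℕ) {w : ℂ} (hw : 1 ≤ w.re) {s : ℝ} (hs : 0 ≤ s) :
    ‖(s : ℂ) ^ n * Complex.exp (-(w * s))‖ ≤ s ^ n * Real.exp (-s) := by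
  rw [norm_mul, norm_pow, Complex.norm_real, Real.norm_of_nonneg hs, Complex.norm_exp]
  gcongr
  simp
  nlinarith

lemma integrableOn_pow_mul_cexp_neg (n : ℕ) {w : ℂ} (hw : 1 ≤ w.re) :
    IntegrableOn (fun s : ℝ => (s : ℂ) ^ n * Complex.exp (-(w * s))) (Set.Ioi 0) := by
  refine Integrable.mono' (integrableOn_pow_mul_exp_neg n)
    (by fun_prop : Continuous _).aestronglyMeasurable ?_
  exact (ae_restrict_iff' measurableSet_Ioi).2
    (.of_forall fun s hs => norm_pow_mul_exp_neg_le n hw (le_of_lt hs))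

lemma tendsto_pow_mul_cexp_neg (n : ℕ) {w : ℂ} (hw : 1 ≤ w.re) :
    Filter.Tendsto (fun s : ℝ => (s : ℂ) ^ n * Complex.exp (-(w * s))) Filter.atTop (nhds 0) :=
  squeeze_zero_norm' ((Filter.eventually_ge_atTop 0).mono fun _ hs =>
    norm_pow_mul_exp_neg_le n hw hs) (Real.tendsto_pow_mul_exp_neg_atTop_nhds_zero n)

lemma hasDerivAt_cexp_neg_mul (w : ℂ) (s : ℝ) :
    HasDerivAt (fun u : ℝ => Complex.exp (-(w * u))) (-w * Complex.exp (-(w * s))) s := by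
  simpa only [mul_comm w] using hasDerivAt_exp_neg_mul w s

lemma integral_pow_mul_cexp_neg (n : ℕ) {w : ℂ} (hw : 1 ≤ w.re) :
    ∫ s in Set.Ioi (0 : ℝ), (s : ℂ) ^ n * Complex.exp (-(w * s))
      = n.factorial * (w⁻¹) ^ (n + 1) := by
  have hw0 : w ≠ 0 := by
    rintro rfl; simp at hw; linarith
  induction n with
  | zero =>
    have hd : ∀ s ∈ Set.Ioi (0 : ℝ), HasDerivAt (fun u : ℝ => Complex.exp (-(w * u)))
        (-w * ((s : ℂ) ^ 0 * Complex.exp (-(w * s)))) s := fun s _ => by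
      simpa using hasDerivAt_cexp_neg_mul w s
    have h := integral_Ioi_of_hasDerivAt_of_tendsto (by fun_prop) hd
      ((integrableOn_pow_mul_cexp_neg 0 hw).const_mul _)
      (by simpa using tendsto_pow_mul_cexp_neg 0 hw)
    rw [integral_const_mul] at h
    simp only [Complex.ofReal_zero, mul_zero, neg_zero, Complex.exp_zero, zero_sub] at h
    rw [Nat.factorial_zero, Nat.cast_one, one_mul, zero_add, pow_one]
    refine eq_inv_of_mul_eq_one_left ?_
    linear_combination -h
  | succ n ih =>
    have hd : ∀ s ∈ Set.Ioi (0 : ℝ),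
        HasDerivAt (fun u : ℝ => (u : ℂ) ^ (n + 1) * Complex.exp (-(w * u)))
        ((n + 1) * ((s : ℂ) ^ n * Complex.exp (-(w * s)))
          + -w * ((s : ℂ) ^ (n + 1) * Complex.exp (-(w * s)))) s := fun s _ => by
      refine (((Complex.ofRealCLM.hasDerivAt (x := s)).pow (n + 1)).mul
        (hasDerivAt_cexp_neg_mul w s)).congr_deriv ?_
      simp
      ring
    have i1 := (integrableOn_pow_mul_cexp_neg n hw).const_mul ((n : ℂ) + 1)
    have i2 := (integrableOn_pow_mul_cexp_neg (n + 1) hw).const_mul (-w)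
    -- Integration by parts: both boundary terms vanish.
    have h := integral_Ioi_of_hasDerivAt_of_tendsto (by fun_prop) hd (i1.add i2)
      (tendsto_pow_mul_cexp_neg (n + 1) hw)
    rw [integral_add i1 i2, integral_const_mul, integral_const_mul, ih] at h
    simp only [Complex.ofReal_zero, zero_pow (Nat.succ_ne_zero n), zero_mul, sub_zero] at h
    have h2 : w * ∫ s in Set.Ioi (0 : ℝ), (s : ℂ) ^ (n + 1) * Complex.exp (-(w * s))
        = (n + 1) * (n.factorial * (w⁻¹) ^ (n + 1)) := by linear_combination -h
    rw [Nat.factorial_succ, pow_succ' w⁻¹ (n + 1)]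
    push_cast
    rw [← mul_right_inj' hw0, h2]
    field_simp

/-- The Laplace transform of the gamma law with integer shape. -/
lemma integral_cexp_neg_gammaProcessLaw (m : ℕ) {w : ℂ} (hw : 0 ≤ w.re) :
    ∫ s, Complex.exp (-(s * w)) ∂gammaProcessLaw m = ((1 + w)⁻¹) ^ m := by
  rcases m with _ | n
  · rw [gammaProcessLaw, if_pos (by simp)]
    simp
  · rw [gammaProcessLaw, if_neg (by positivity), integral_gammaMeasure_nat]
    have hf : (n.factorial : ℂ) ≠ 0 := by exact_mod_cast n.factorial_ne_zero
    have e : ∀ s : ℝ, ((s ^ n * Real.exp (-s) / n.factorial : ℝ) : ℂ) * Complex.exp (-(s * w))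
        = (n.factorial : ℂ)⁻¹ * ((s : ℂ) ^ n * Complex.exp (-((1 + w) * s))) := by
      intro s
      rw [show -((1 + w) * (s : ℂ)) = -s + -(s * w) by ring, Complex.exp_add]
      push_cast
      ring
    simp_rw [e]
    rw [integral_const_mul, integral_pow_mul_cexp_neg n (by simpa using hw)]
    field_simp

lemma integrable_cexp_neg_abs_gammaProcessLaw (m : ℕ) {w : ℂ} (hw : 0 ≤ w.re) :
    Integrable (fun s : ℝ => Complex.exp (-(|s| * w))) (gammaProcessLaw m) := by
  have := isProbabilityMeasure_gammaProcessLaw (u := m) (by positivity)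
  refine Integrable.mono' (integrable_const (1 : ℝ))
    (by fun_prop : Continuous _).aestronglyMeasurable (.of_forall fun s => ?_)
  exact norm_exp_neg_mul_le_one hw (abs_nonneg s)

/-- The Fourier representation of `L_t` of an Erlang distribution function at `m / t`. -/
lemma gammaOp_erlangCDF_eq_symbolMean {a t : ℝ} (ha : 0 < a) (ht : 0 < t) (j : ℕ+) (m : ℕ) :
    (gammaOp t (erlangCDF a j) (m / t) : ℂ)
      = symbolMean j.natPred (fun w => 1 - ((1 + (a / t : ℝ) * w)⁻¹) ^ m) := by
  set k := j.natPred with hk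
  have := isProbabilityMeasure_gammaProcessLaw (u := m) (by positivity)
  have hπ' : -Real.pi ≤ Real.pi := by linarith [Real.pi_pos]
  have hat : 0 < a / t := by positivity
  have hfin : IsFiniteMeasure (volume.restrict (Set.uIoc (-Real.pi) Real.pi)) := by
    rw [Set.uIoc_of_le hπ']; infer_instance
  -- Writing `|s|` changes nothing almost surely and makes the exponential bounds valid for every
  -- real `s`.
  have h1 : ∀ᵐ s ∂gammaProcessLaw m, ((erlangCDF a j (s / t) : ℝ) : ℂ)
      = (2 * Real.pi)⁻¹ * ∫ φ in -Real.pi..Real.pi, Complex.exp (-(k * Complex.I * φ))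
        * ((1 - Complex.exp (-(|s| * ((a / t : ℝ) * circGap φ)))) / circGap φ) := by
    filter_upwards [ae_nonneg_gammaProcessLaw m] with s hs
    rw [erlangCDF_eq_symbolMean ha j (div_nonneg hs ht.le), symbolMean, abs_of_nonneg hs]
    have e : ∀ φ : ℝ, (a : ℂ) * (s / t : ℝ) * circGap φ = s * ((a / t : ℝ) * circGap φ) := by
      intro φ; push_cast; ring
    simp only [e, hk]
  have hw : ∀ φ : ℝ, 0 ≤ (((a / t : ℝ) : ℂ) * circGap φ).re := fun φ => by
    rw [Complex.re_ofReal_mul]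
    exact mul_nonneg hat.le (circGap_re_nonneg φ)
  rw [gammaOp, mul_div_cancel₀ _ ht.ne', ← integral_complex_ofReal, integral_congr_ae h1,
    integral_const_mul, symbolMean, ← intervalIntegral_integral_swap]
  · congr 1
    refine intervalIntegral.integral_congr fun φ _ => ?_
    rw [integral_const_mul, integral_div, integral_sub (integrable_const _)
      (integrable_cexp_neg_abs_gammaProcessLaw m (hw φ)), integral_const]
    have h2 : ∫ s, Complex.exp (-(|s| * ((a / t : ℝ) * circGap φ))) ∂gammaProcessLaw m
        = ∫ s, Complex.exp (-(s * ((a / t : ℝ) * circGap φ))) ∂gammaProcessLaw m := by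
      refine integral_congr_ae ?_
      filter_upwards [ae_nonneg_gammaProcessLaw m] with s hs
      rw [abs_of_nonneg hs]
    rw [h2, integral_cexp_neg_gammaProcessLaw m (hw φ)]
    simp
  · refine Integrable.mono' (g := fun p : ℝ × ℝ => a / t * ‖p.2‖)
      (((integrable_id_gammaProcessLaw m).norm.comp_snd _).const_mul _) ?_ (.of_forall ?_)
    · refine Measurable.aestronglyMeasurable ?_
      simp only [Function.uncurry_def]
      have := continuous_circGap.measurable
      fun_prop
    · rintro ⟨φ, s⟩
      simp only [Function.uncurry_apply_pair]
      rw [norm_mul, norm_exp_neg_nat_mul_I, one_mul, norm_div]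
      refine div_le_of_le_mul₀ (norm_nonneg _) (by positivity) ?_
      refine (norm_one_sub_exp_neg_le ?_).trans (le_of_eq ?_)
      · rw [Complex.re_ofReal_mul]; exact mul_nonneg (abs_nonneg s) (hw φ)
      · rw [norm_mul, norm_mul, Complex.norm_real, Complex.norm_real, Real.norm_of_nonneg hat.le,
          Real.norm_eq_abs, abs_abs, Real.norm_eq_abs]
        ring

/-! ### Linearity and bounds for symbol means -/

/-- The integrand of `symbolMean k Φ` is integrable. -/
def SymbolIntegrable (k : ℕ) (Φ : ℂ → ℂ) : Prop :=
  IntervalIntegrable (fun φ : ℝ => Complex.exp (-(k * Complex.I * φ)) *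
    (Φ (circGap φ) / circGap φ)) volume (-Real.pi) Real.pi

/-- Vanishing of `Φ` to first order at 0 compensates the pole of `1 / θ` at `φ = 0`. -/
lemma symbolIntegrable_of_norm_le (k : ℕ) {Φ : ℂ → ℂ} (hΦ : Measurable Φ) {C : ℝ} (hC : 0 ≤ C)
    (h : ∀ w : ℂ, 0 ≤ w.re → ‖Φ w‖ ≤ C * ‖w‖) : SymbolIntegrable k Φ := by
  refine (intervalIntegrable_const (c := C)).mono_fun ?_ (.of_forall fun φ => ?_)
  · have := continuous_circGap.measurable
    refine Measurable.aestronglyMeasurable ?_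
    fun_prop
  · simp only
    rw [norm_mul, norm_exp_neg_nat_mul_I, one_mul, norm_div, Real.norm_of_nonneg hC]
    exact div_le_of_le_mul₀ (norm_nonneg _) hC (h _ (circGap_re_nonneg φ))

lemma symbolIntegrable_one_sub_exp (k : ℕ) {c : ℝ} (hc : 0 ≤ c) :
    SymbolIntegrable k (fun w => 1 - Complex.exp (-(c * w))) := by
  refine symbolIntegrable_of_norm_le k (by fun_prop) hc fun w hw => ?_
  refine (norm_one_sub_exp_neg_le ?_).trans (le_of_eq ?_)
  · rw [Complex.re_ofReal_mul]; exact mul_nonneg hc hw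
  · rw [norm_mul, Complex.norm_real, Real.norm_of_nonneg hc]

lemma norm_one_sub_pow_le {z : ℂ} (hz : ‖z‖ ≤ 1) (m : ℕ) : ‖1 - z ^ m‖ ≤ m * ‖1 - z‖ := by
  induction m with
  | zero => simp
  | succ m ih =>
    calc ‖1 - z ^ (m + 1)‖ = ‖(1 - z) + z * (1 - z ^ m)‖ := by congr 1; ring
      _ ≤ ‖1 - z‖ + ‖z‖ * ‖1 - z ^ m‖ := (norm_add_le _ _).trans (by rw [norm_mul])
      _ ≤ ‖1 - z‖ + 1 * (m * ‖1 - z‖) := by gcongr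
      _ = _ := by push_cast; ring

lemma symbolIntegrable_one_sub_inv_pow (k : ℕ) {c : ℝ} (hc : 0 ≤ c) (m : ℕ) :
    SymbolIntegrable k (fun w => 1 - ((1 + c * w)⁻¹) ^ m) := by
  refine symbolIntegrable_of_norm_le k (by fun_prop) (mul_nonneg m.cast_nonneg hc) fun w hw => ?_
  have hn : 1 ≤ ‖1 + c * w‖ := by
    refine le_trans ?_ (Complex.re_le_norm _)
    rw [Complex.add_re, Complex.re_ofReal_mul, Complex.one_re]
    linarith [mul_nonneg hc hw]
  have h0 : 1 + c * w ≠ 0 := norm_pos_iff.1 (by linarith)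
  have h1 : ‖(1 + c * w)⁻¹‖ ≤ 1 := by
    rw [norm_inv]; exact inv_le_one_of_one_le₀ hn
  refine (norm_one_sub_pow_le h1 m).trans ?_
  have e : 1 - (1 + c * w)⁻¹ = c * w * (1 + c * w)⁻¹ := by field_simp; ring
  rw [e, norm_mul, norm_mul, Complex.norm_real, Real.norm_of_nonneg hc]
  calc _ = m * c * ‖w‖ * ‖(1 + c * w)⁻¹‖ := by ring
    _ ≤ m * c * ‖w‖ := mul_le_of_le_one_right (by positivity) h1

lemma symbolMean_linear (k : ℕ) (c₁ c₂ c₃ : ℂ) {Φ₁ Φ₂ Φ₃ : ℂ → ℂ} (h₁ : SymbolIntegrable k Φ₁)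
    (h₂ : SymbolIntegrable k Φ₂) (h₃ : SymbolIntegrable k Φ₃) :
    symbolMean k (fun w => c₁ * Φ₁ w + c₂ * Φ₂ w + c₃ * Φ₃ w)
      = c₁ * symbolMean k Φ₁ + c₂ * symbolMean k Φ₂ + c₃ * symbolMean k Φ₃ := by
  have e : ∀ φ : ℝ, Complex.exp (-(k * Complex.I * φ)) *
      ((c₁ * Φ₁ (circGap φ) + c₂ * Φ₂ (circGap φ) + c₃ * Φ₃ (circGap φ)) / circGap φ)
      = c₁ * (Complex.exp (-(k * Complex.I * φ)) * (Φ₁ (circGap φ) / circGap φ))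
        + c₂ * (Complex.exp (-(k * Complex.I * φ)) * (Φ₂ (circGap φ) / circGap φ))
        + c₃ * (Complex.exp (-(k * Complex.I * φ)) * (Φ₃ (circGap φ) / circGap φ)) := by
    intro φ; ring
  simp only [symbolMean, e]
  rw [intervalIntegral.integral_add ((h₁.const_mul c₁).add (h₂.const_mul c₂)) (h₃.const_mul c₃),
    intervalIntegral.integral_add (h₁.const_mul c₁) (h₂.const_mul c₂),
    intervalIntegral.integral_const_mul, intervalIntegral.integral_const_mul,
    intervalIntegral.integral_const_mul]
  ring

/-- The factor `exp (-ikφ)` has modulus 1, so the bound does not depend on `k`. -/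
lemma norm_symbolMean_le (k : ℕ) {Φ : ℂ → ℂ} {g : ℝ → ℝ} (hg : Continuous g)
    (h : ∀ φ : ℝ, |φ| ≤ Real.pi → ‖Φ (circGap φ) / circGap φ‖ ≤ g φ) :
    ‖symbolMean k Φ‖ ≤ (2 * Real.pi)⁻¹ * ∫ φ in -Real.pi..Real.pi, g φ := by
  have hπ := Real.pi_pos
  rw [symbolMean, norm_mul, Complex.norm_real, Real.norm_of_nonneg (by positivity)]
  gcongr
  refine intervalIntegral.norm_integral_le_of_norm_le (by linarith) (.of_forall fun φ hφ => ?_)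
    (hg.intervalIntegrable _ _)
  rw [norm_mul, norm_exp_neg_nat_mul_I, one_mul]
  exact h φ (abs_le.2 ⟨hφ.1.le, hφ.2⟩)

/-! ### Error bounds for a single Erlang distribution -/

/-- The error of the accelerated operator at the points `m / t`. -/
lemma abs_gammaOpTwo_erlangCDF_sub_le {a t : ℝ} (ha : 0 < a) (ht : 0 < t) (hat : a ≤ t) (j : ℕ+)
    (m : ℕ) :
    |gammaOpTwo t (erlangCDF a j) (m / t) - erlangCDF a j (m / t)|
      ≤ (a / t) ^ 2 * (35 / 48 + 9 * Real.pi ^ 3 / 256) := by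
  have hρ : 0 < a / t := by positivity
  have hπ := Real.pi_pos
  set k := j.natPred with hk
  have hA := gammaOp_erlangCDF_eq_symbolMean ha ht j m
  -- For the parameter `2 * t` the same point is `2m / (2t)`, so the shape doubles.
  have hB := gammaOp_erlangCDF_eq_symbolMean ha (mul_pos two_pos ht) j (2 * m)
  have e0 : ((2 * m : ℕ) : ℝ) / (2 * t) = m / t := by push_cast; field_simp
  rw [e0] at hB
  have hC := erlangCDF_eq_symbolMean ha j (x := m / t) (by positivity)
  have i2 : SymbolIntegrable k (fun w => 1 - Complex.exp (-(a * (m / t : ℝ) * w))) := by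
    have := symbolIntegrable_one_sub_exp k (c := a * (m / t)) (by positivity)
    push_cast at this ⊢
    exact this
  have hsum := symbolMean_linear k 2 (-1) (-1)
    (symbolIntegrable_one_sub_inv_pow k (c := a / (2 * t)) (by positivity) (2 * m))
    (symbolIntegrable_one_sub_inv_pow k hρ.le m) i2
  rw [← hA, ← hB, ← hC] at hsum
  obtain ⟨h, hc, hint, hbd⟩ := exists_majorant_kernel_pow hρ ((div_le_one ht).2 hat) m
  have hle := norm_symbolMean_le k (g := fun φ => (a / t) ^ 2 * (35 / 48 + h φ))
    (Φ := fun w => 2 * (1 - ((1 + ((a / (2 * t) : ℝ) : ℂ) * w)⁻¹) ^ (2 * m))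
      + -1 * (1 - ((1 + ((a / t : ℝ) : ℂ) * w)⁻¹) ^ m)
      + -1 * (1 - Complex.exp (-(a * (m / t : ℝ) * w)))) (by fun_prop) (fun φ hφ => by
        refine le_trans (le_of_eq ?_) (hbd φ hφ)
        congr 2
        have e1 : ((a / (2 * t) : ℝ) : ℂ) = ((a / t : ℝ) : ℂ) / 2 := by push_cast; ring
        have e2 : Complex.exp (-(((a / t : ℝ) : ℂ) * circGap φ)) ^ m
            = Complex.exp (-(a * (m / t : ℝ) * circGap φ)) := by
          rw [← Complex.exp_nat_mul]; congr 1; push_cast; ring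
        rw [e1, e2, pow_mul]
        ring)
  rw [hsum] at hle
  have e3 : (2 : ℂ) * (gammaOp (2 * t) (erlangCDF a j) (m / t) : ℝ)
      + -1 * (gammaOp t (erlangCDF a j) (m / t) : ℝ) + -1 * (erlangCDF a j (m / t) : ℝ)
      = ((gammaOpTwo t (erlangCDF a j) (m / t) - erlangCDF a j (m / t) : ℝ) : ℂ) := by
    rw [gammaOpTwo]; push_cast; ring
  rw [e3, Complex.norm_real, Real.norm_eq_abs] at hle
  refine hle.trans ?_
  rw [intervalIntegral.integral_const_mul, intervalIntegral.integral_add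
    intervalIntegrable_const (hc.intervalIntegrable _ _), intervalIntegral.integral_const]
  calc _ ≤ (2 * Real.pi)⁻¹ * ((a / t) ^ 2 * ((Real.pi - -Real.pi) • (35 / 48 : ℝ)
        + 2 * Real.pi * (9 * Real.pi ^ 3 / 256))) := by gcongr
    _ = _ := by rw [smul_eq_mul]; field_simp; ring

/-- The error of linear interpolation of an Erlang distribution function. -/
lemma abs_interp_erlangCDF_sub_le {a : ℝ} (ha : 0 < a) (j : ℕ+) {x₀ x₁ l : ℝ} (h0 : 0 ≤ x₀)
    (h01 : x₀ ≤ x₁) (hl0 : 0 ≤ l) (hl1 : l ≤ 1) :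
    |l * erlangCDF a j x₁ + (1 - l) * erlangCDF a j x₀ - erlangCDF a j (l * x₁ + (1 - l) * x₀)|
      ≤ (a * (x₁ - x₀)) ^ 2 * (Real.pi / 16) := by
  set x := l * x₁ + (1 - l) * x₀ with hx
  set k := j.natPred with hk
  have hπ := Real.pi_pos
  have h1 : 0 ≤ x₁ := h0.trans h01
  have hx0 : 0 ≤ x := add_nonneg (mul_nonneg hl0 h1) (mul_nonneg (by linarith) h0)
  have i : ∀ y : ℝ, 0 ≤ y → SymbolIntegrable k (fun w => 1 - Complex.exp (-(a * y * w))) := by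
    intro y hy
    have := symbolIntegrable_one_sub_exp k (c := a * y) (by positivity)
    push_cast at this
    exact this
  have hsum := symbolMean_linear k l (1 - l) (-1) (i x₁ h1) (i x₀ h0) (i x hx0)
  rw [← erlangCDF_eq_symbolMean ha j h1, ← erlangCDF_eq_symbolMean ha j h0,
    ← erlangCDF_eq_symbolMean ha j hx0] at hsum
  have hle := norm_symbolMean_le k (g := fun φ => (a * (x₁ - x₀)) ^ 2 / 8 * |φ|)
    (Φ := fun w => l * (1 - Complex.exp (-(a * x₁ * w)))
      + (1 - l) * (1 - Complex.exp (-(a * x₀ * w)))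
      + -1 * (1 - Complex.exp (-(a * x * w)))) (by fun_prop) (fun φ hφ => by
        have hre : ∀ y : ℝ, 0 ≤ y → 0 ≤ ((a : ℂ) * y * circGap φ).re := fun y hy => by
          rw [← Complex.ofReal_mul, Complex.re_ofReal_mul]
          exact mul_nonneg (mul_nonneg ha.le hy) (circGap_re_nonneg φ)
        have t1 := norm_exp_neg_taylor_two_le (hre x hx0) (hre x₁ h1)
        have t0 := norm_exp_neg_taylor_two_le (hre x hx0) (hre x₀ h0)
        set N := ‖circGap φ‖ with hN
        have n1 : ‖(a : ℂ) * x₁ * circGap φ - a * x * circGap φ‖ = a * (1 - l) * (x₁ - x₀) * N := by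
          have : (a : ℂ) * x₁ * circGap φ - a * x * circGap φ
              = ((a * (1 - l) * (x₁ - x₀) : ℝ) : ℂ) * circGap φ := by
            rw [hx]; push_cast; ring
          rw [this, norm_mul, Complex.norm_real, Real.norm_of_nonneg
            (mul_nonneg (mul_nonneg ha.le (by linarith)) (by linarith))]
        have n0 : ‖(a : ℂ) * x₀ * circGap φ - a * x * circGap φ‖ = a * l * (x₁ - x₀) * N := by
          have : (a : ℂ) * x₀ * circGap φ - a * x * circGap φ
              = -(((a * l * (x₁ - x₀) : ℝ) : ℂ) * circGap φ) := by
            rw [hx]; push_cast; ring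
          rw [this, norm_neg, norm_mul, Complex.norm_real, Real.norm_of_nonneg
            (mul_nonneg (mul_nonneg ha.le hl0) (by linarith))]
        rw [n1] at t1
        rw [n0] at t0
        rw [norm_div]
        refine div_le_of_le_mul₀ (norm_nonneg _) (by positivity) ?_
        have hNφ : N ≤ |φ| := norm_circGap_le_abs φ
        set E₁ := Complex.exp (-(a * x₁ * circGap φ))
        set E₀ := Complex.exp (-(a * x₀ * circGap φ))
        set E := Complex.exp (-(a * x * circGap φ))
        -- Taylor expansion at `x`: the first order terms cancel because `x` is the barycentre of
        -- the nodes.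
        have e : l * (1 - E₁) + (1 - l) * (1 - E₀) + -1 * (1 - E)
            = -(((l : ℝ) : ℂ) * (E₁ - E + ((a : ℂ) * x₁ * circGap φ - a * x * circGap φ) * E)
              + ((1 - l : ℝ) : ℂ) * (E₀ - E + ((a : ℂ) * x₀ * circGap φ - a * x * circGap φ) * E)) := by
          rw [hx]; push_cast; ring
        rw [e, norm_neg]
        refine (norm_add_le _ _).trans ?_
        rw [norm_mul, norm_mul, Complex.norm_real, Complex.norm_real, Real.norm_of_nonneg hl0,
          Real.norm_of_nonneg (by linarith : 0 ≤ 1 - l)]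
        calc _ ≤ l * ((a * (1 - l) * (x₁ - x₀) * N) ^ 2 / 2)
              + (1 - l) * ((a * l * (x₁ - x₀) * N) ^ 2 / 2) := by
              gcongr
          _ = (a * (x₁ - x₀)) ^ 2 / 2 * (l * (1 - l)) * N * N := by ring
          -- One factor `N` cancels `1 / θ`; the other is at most `|φ|`, of mean `π / 2`. With `l *
          -- (1 - l) ≤ 1 / 4` this yields `π / 16`.
          _ ≤ (a * (x₁ - x₀)) ^ 2 / 2 * (1 / 4) * |φ| * N := by
              gcongr
              nlinarith [sq_nonneg (l - 1 / 2)]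
          _ = _ := by ring)
  rw [hsum] at hle
  have e3 : (l : ℂ) * (erlangCDF a j x₁ : ℝ) + (1 - l) * (erlangCDF a j x₀ : ℝ)
      + -1 * (erlangCDF a j x : ℝ)
      = ((l * erlangCDF a j x₁ + (1 - l) * erlangCDF a j x₀ - erlangCDF a j x : ℝ) : ℂ) := by
    push_cast; ring
  rw [e3, Complex.norm_real, Real.norm_eq_abs, intervalIntegral.integral_const_mul,
    integral_abs_neg_pi_pi] at hle
  refine hle.trans (le_of_eq ?_)
  field_simp
  ring

lemma erlangCDF_nonneg (a : ℝ) (j : ℕ+) (x : ℝ) : 0 ≤ erlangCDF a j x := cdf_nonneg _ x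

lemma erlangCDF_le_one (a : ℝ) (j : ℕ+) (x : ℝ) : erlangCDF a j x ≤ 1 := cdf_le_one _ x

lemma monotone_erlangCDF (a : ℝ) (j : ℕ+) : Monotone (erlangCDF a j) := monotone_cdf _

lemma gammaOp_erlangCDF_mem_Icc (a : ℝ) {t x : ℝ} (j : ℕ+) (htx : 0 ≤ t * x) :
    0 ≤ gammaOp t (erlangCDF a j) x ∧ gammaOp t (erlangCDF a j) x ≤ 1 := by
  have := isProbabilityMeasure_gammaProcessLaw htx
  refine ⟨integral_nonneg fun s => erlangCDF_nonneg _ _ _, ?_⟩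
  have := integral_mono_of_nonneg (μ := gammaProcessLaw (t * x))
    (f := fun s => erlangCDF a j (s / t)) (g := fun _ => 1)
    (.of_forall fun s => erlangCDF_nonneg _ _ _) (integrable_const _)
    (.of_forall fun s => erlangCDF_le_one _ _ _)
  simpa [gammaOp] using this

/-- Numerically about 2.016 against 2.038. -/
lemma error_constant_le : 35 / 48 + 9 * Real.pi ^ 3 / 256 + Real.pi / 16
    ≤ 17 / 12 + 27 / (16 * Real.exp 1) := by
  have h1 : Real.pi ≤ 3.15 := Real.pi_lt_d2.le
  have h2 : Real.pi ^ 3 ≤ 3.15 ^ 3 := pow_le_pow_left₀ Real.pi_pos.le h1 3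
  have h3 : (27 : ℝ) / (16 * 2.72) ≤ 27 / (16 * Real.exp 1) := by
    have := Real.exp_one_lt_d9
    gcongr
    linarith
  norm_num at h2 h3
  linarith

lemma two_le_error_constant : 2 ≤ 17 / 12 + 27 / (16 * Real.exp 1) := by
  have h3 : (27 : ℝ) / (16 * 2.72) ≤ 27 / (16 * Real.exp 1) := by
    have := Real.exp_one_lt_d9
    gcongr
    linarith
  norm_num at h3
  linarith

/-- The error of the interpolated accelerated operator on a single Erlang distribution function. -/
lemma abs_interpOpTwo_erlangCDF_sub_le {a t : ℝ} (ha : 0 < a) (ht : 0 < t) (j : ℕ+) {x : ℝ}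
    (hx : 0 ≤ x) :
    |interpOpTwo t (erlangCDF a j) x - erlangCDF a j x|
      ≤ (17 / 12 + 27 / (16 * Real.exp 1)) * (a / t) ^ 2 := by
  set n := ⌊t * x⌋₊ with hn
  have hl0 : 0 ≤ t * x - n := sub_nonneg.2 (Nat.floor_le (by positivity))
  have hl1 : t * x - n ≤ 1 := by linarith [Nat.lt_floor_add_one (t * x)]
  set l := t * x - n with hl
  have e1 : interpOpTwo t (erlangCDF a j) x = l * gammaOpTwo t (erlangCDF a j) ((n + 1) / t)
      + (1 - l) * gammaOpTwo t (erlangCDF a j) (n / t) := by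
    rw [interpOpTwo, hl]; ring
  rcases le_or_gt a t with hat | hat
  · have b1 := abs_gammaOpTwo_erlangCDF_sub_le ha ht hat j (n + 1)
    have b0 := abs_gammaOpTwo_erlangCDF_sub_le ha ht hat j n
    have bi := abs_interp_erlangCDF_sub_le ha j (x₀ := n / t) (x₁ := (n + 1) / t) (l := l)
      (by positivity) (by gcongr; linarith) hl0 hl1
    have ex : l * ((n + 1) / t) + (1 - l) * (n / t) = x := by
      rw [hl]; field_simp; ring
    have ed : a * ((n + 1) / t - n / t) = a / t := by ring
    rw [ex, ed] at bi
    push_cast at b1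
    have hK := mul_le_mul_of_nonneg_right error_constant_le (sq_nonneg (a / t))
    set B := (a / t) ^ 2 * (35 / 48 + 9 * Real.pi ^ 3 / 256) with hB
    have e2 : interpOpTwo t (erlangCDF a j) x - erlangCDF a j x
        = l * (gammaOpTwo t (erlangCDF a j) ((n + 1) / t) - erlangCDF a j ((n + 1) / t))
        + (1 - l) * (gammaOpTwo t (erlangCDF a j) (n / t) - erlangCDF a j (n / t))
        + (l * erlangCDF a j ((n + 1) / t) + (1 - l) * erlangCDF a j (n / t)
          - erlangCDF a j x) := by rw [e1]; ring
    rw [e2]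
    refine (abs_add_three _ _ _).trans ?_
    rw [abs_mul, abs_mul, abs_of_nonneg hl0, abs_of_nonneg (by linarith : 0 ≤ 1 - l)]
    have c1 := mul_le_mul_of_nonneg_left b1 hl0
    have c0 := mul_le_mul_of_nonneg_left b0 (by linarith : 0 ≤ 1 - l)
    linarith
  -- Here `L_t^{[2]}` takes values in `[-1, 2]` and the distribution function in `[0, 1]`, so the
  -- error is at most 2.
  · have h2 : (1 : ℝ) ≤ (a / t) ^ 2 := one_le_pow₀ ((one_le_div ht).2 hat.le)
    have hb : ∀ y : ℝ, 0 ≤ y → -1 ≤ gammaOpTwo t (erlangCDF a j) y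
        ∧ gammaOpTwo t (erlangCDF a j) y ≤ 2 := fun y hy => by
      have g1 := gammaOp_erlangCDF_mem_Icc a j (mul_nonneg (mul_pos two_pos ht).le hy)
      have g2 := gammaOp_erlangCDF_mem_Icc a j (mul_nonneg ht.le hy)
      unfold gammaOpTwo
      constructor <;> linarith
    have b1 := hb ((n + 1) / t) (by positivity)
    have b0 := hb (n / t) (by positivity)
    have f0 := erlangCDF_nonneg a j x
    have f1 := erlangCDF_le_one a j x
    have hl1' : 0 ≤ 1 - l := by linarith
    have : |interpOpTwo t (erlangCDF a j) x - erlangCDF a j x| ≤ 2 := by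
      rw [e1, abs_le]
      constructor
      · linarith [mul_le_mul_of_nonneg_left b1.1 hl0, mul_le_mul_of_nonneg_left b0.1 hl1']
      · linarith [mul_le_mul_of_nonneg_left b1.2 hl0, mul_le_mul_of_nonneg_left b0.2 hl1']
    nlinarith [two_le_error_constant]

/-! ### Infinite and finite mixtures -/

section Mixture

variable {q : ℕ+ → ℝ}

lemma summable_mul_erlangCDF (hq : ∀ j, 0 ≤ q j) (hs : Summable q) (a x : ℝ) :
    Summable fun j => q j * erlangCDF a j x :=
  hs.of_nonneg_of_le (fun j => mul_nonneg (hq j) (erlangCDF_nonneg a j x))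
    fun j => mul_le_of_le_one_right (hq j) (erlangCDF_le_one a j x)

/-- Monotonicity is the source of measurability for the infinite mixture. -/
lemma monotone_tsum_erlangCDF (hq : ∀ j, 0 ≤ q j) (hs : Summable q) (a : ℝ) :
    Monotone fun x => ∑' j, q j * erlangCDF a j x := fun x y hxy =>
  (summable_mul_erlangCDF hq hs a x).tsum_le_tsum
    (fun j => mul_le_mul_of_nonneg_left (monotone_erlangCDF a j hxy) (hq j))
    (summable_mul_erlangCDF hq hs a y)

lemma integrable_tsum_erlangCDF (hq : ∀ j, 0 ≤ q j) (hs : Summable q) (a t : ℝ) (μ : Measure ℝ)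
    [IsFiniteMeasure μ] : Integrable (fun s => ∑' j, q j * erlangCDF a j (s / t)) μ := by
  refine Integrable.mono' (integrable_const (∑' j, q j)) ?_ (.of_forall fun s => ?_)
  · exact ((monotone_tsum_erlangCDF hq hs a).measurable.comp
      (measurable_id.div_const t)).aestronglyMeasurable
  · rw [Real.norm_of_nonneg (tsum_nonneg fun j => mul_nonneg (hq j) (erlangCDF_nonneg a j _))]
    exact (summable_mul_erlangCDF hq hs a _).tsum_le_tsum
      (fun j => mul_le_of_le_one_right (hq j) (erlangCDF_le_one a j _)) hs

lemma hasSum_gammaOp (hq : ∀ j, 0 ≤ q j) (hs : Summable q) (a : ℝ) {t x : ℝ}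
    (htx : 0 ≤ t * x) :
    HasSum (fun j => q j * gammaOp t (erlangCDF a j) x)
      (gammaOp t (fun y => ∑' j, q j * erlangCDF a j y) x) := by
  have := isProbabilityMeasure_gammaProcessLaw htx
  have hi : ∀ j, Integrable (fun s => q j * erlangCDF a j (s / t)) (gammaProcessLaw (t * x)) := by
    intro j
    refine Integrable.const_mul (Integrable.mono' (integrable_const (1 : ℝ)) ?_
      (.of_forall fun s => ?_)) _
    · exact ((monotone_erlangCDF a j).measurable.comp
        (measurable_id.div_const t)).aestronglyMeasurable
    · rw [Real.norm_of_nonneg (erlangCDF_nonneg a j _)]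
      exact erlangCDF_le_one a j _
  have h := hasSum_integral_of_summable_integral_norm hi (by
    refine hs.of_nonneg_of_le (fun j => integral_nonneg fun s => norm_nonneg _) fun j => ?_
    have e : ∀ s, ‖q j * erlangCDF a j (s / t)‖ = q j * erlangCDF a j (s / t) := fun s =>
      Real.norm_of_nonneg (mul_nonneg (hq j) (erlangCDF_nonneg a j _))
    simp only [e]
    rw [integral_const_mul]
    exact mul_le_of_le_one_right (hq j) (gammaOp_erlangCDF_mem_Icc a j htx).2)
  simp only [integral_const_mul] at h
  exact h

lemma hasSum_gammaOpTwo (hq : ∀ j, 0 ≤ q j) (hs : Summable q) (a : ℝ) {t x : ℝ}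
    (ht : 0 < t) (hx : 0 ≤ x) :
    HasSum (fun j => q j * gammaOpTwo t (erlangCDF a j) x)
      (gammaOpTwo t (fun y => ∑' j, q j * erlangCDF a j y) x) := by
  have h := ((hasSum_gammaOp hq hs a (mul_nonneg (mul_pos two_pos ht).le hx)).mul_left 2).sub
    (hasSum_gammaOp hq hs a (mul_nonneg ht.le hx))
  have e : (fun j => q j * gammaOpTwo t (erlangCDF a j) x)
      = fun j => 2 * (q j * gammaOp (2 * t) (erlangCDF a j) x)
        - q j * gammaOp t (erlangCDF a j) x := by
    funext j; rw [gammaOpTwo]; ring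
  rw [e]
  exact h

lemma hasSum_interpOpTwo (hq : ∀ j, 0 ≤ q j) (hs : Summable q) (a : ℝ) {t : ℝ}
    (ht : 0 < t) (x : ℝ) :
    HasSum (fun j => q j * interpOpTwo t (erlangCDF a j) x)
      (interpOpTwo t (fun y => ∑' j, q j * erlangCDF a j y) x) := by
  have h := ((hasSum_gammaOpTwo hq hs a ht (x := (⌊t * x⌋₊ + 1) / t) (by positivity)).mul_left
      (t * x - ⌊t * x⌋₊)).add
    ((hasSum_gammaOpTwo hq hs a ht (x := ⌊t * x⌋₊ / t) (by positivity)).mul_left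
      (⌊t * x⌋₊ + 1 - t * x))
  have e : (fun j => q j * interpOpTwo t (erlangCDF a j) x)
      = fun j => (t * x - ⌊t * x⌋₊) * (q j * gammaOpTwo t (erlangCDF a j) ((⌊t * x⌋₊ + 1) / t))
        + (⌊t * x⌋₊ + 1 - t * x) * (q j * gammaOpTwo t (erlangCDF a j) (⌊t * x⌋₊ / t)) := by
    funext j; rw [interpOpTwo]; ring
  rw [e]
  exact h

lemma abs_interpOpTwo_tsum_sub_le (hq : ∀ j, 0 ≤ q j) (hs : Summable q) {a t x : ℝ} (ha : 0 < a)
    (ht : 0 < t) (hx : 0 ≤ x) :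
    |interpOpTwo t (fun y => ∑' j, q j * erlangCDF a j y) x - ∑' j, q j * erlangCDF a j x|
      ≤ (17 / 12 + 27 / (16 * Real.exp 1)) * ((∑' j, q j) * a ^ 2) / t ^ 2 := by
  have h := (hasSum_interpOpTwo hq hs a ht x).sub (summable_mul_erlangCDF hq hs a x).hasSum
  have hK := hs.hasSum.mul_right ((17 / 12 + 27 / (16 * Real.exp 1)) * (a / t) ^ 2)
  rw [← h.tsum_eq, ← Real.norm_eq_abs]
  refine (tsum_of_norm_bounded hK fun j => ?_).trans (le_of_eq (by ring))
  rw [← mul_sub, norm_mul, Real.norm_of_nonneg (hq j), Real.norm_eq_abs]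
  exact mul_le_mul_of_nonneg_left (abs_interpOpTwo_erlangCDF_sub_le ha ht j hx) (hq j)

end Mixture

section FiniteMixture

variable {n : ℕ} {G : Fin n → ℝ → ℝ} {F : ℝ → ℝ} {c : ℝ}

/-- `F` is prescribed on `[0, ∞)` only, which carries every gamma law. -/
lemma integrable_of_eq_add_sum (hF : ∀ x, 0 ≤ x → F x = c + ∑ i, G i x) {t : ℝ} (ht : 0 < t)
    {u : ℝ} (hu : 0 ≤ u) (hG : ∀ i, Integrable (fun s => G i (s / t)) (gammaProcessLaw u)) :
    Integrable (fun s => F (s / t)) (gammaProcessLaw u) := by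
  have := isProbabilityMeasure_gammaProcessLaw hu
  refine ((integrable_const c).add (integrable_finsetSum Finset.univ fun i _ => hG i)).congr ?_
  filter_upwards [ae_nonneg_gammaProcessLaw u] with s hs
  rw [hF _ (div_nonneg hs ht.le)]
  simp

lemma gammaOp_of_eq_add_sum (hF : ∀ x, 0 ≤ x → F x = c + ∑ i, G i x)
    (hG : ∀ i, GammaOpDefined (G i)) {t x : ℝ} (ht : 0 < t) (hx : 0 ≤ x) : gammaOp t F x = c + ∑ i, gammaOp t (G i) x := by
  have := isProbabilityMeasure_gammaProcessLaw (mul_nonneg ht.le hx)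
  have h : gammaOp t F x = ∫ s, (c + ∑ i, G i (s / t)) ∂gammaProcessLaw (t * x) := by
    refine integral_congr_ae ?_
    filter_upwards [ae_nonneg_gammaProcessLaw (t * x)] with s hs
    rw [hF _ (div_nonneg hs ht.le)]
  rw [h, integral_add (integrable_const c)
    (integrable_finsetSum Finset.univ fun i _ => hG i t ht x hx),
    integral_finsetSum _ fun i _ => hG i t ht x hx]
  simp [gammaOp]

/-- Constants are reproduced: the laws have mass 1, `2 - 1 = 1`, and the interpolation weights sum
to 1. Hence the constant part of `F` contributes no error. -/
lemma interpOpTwo_of_eq_add_sum (hF : ∀ x, 0 ≤ x → F x = c + ∑ i, G i x)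
    (hG : ∀ i, GammaOpDefined (G i)) {t : ℝ} (ht : 0 < t) (x : ℝ) :
    interpOpTwo t F x = c + ∑ i, interpOpTwo t (G i) x := by
  have h2 : ∀ y, 0 ≤ y → gammaOpTwo t F y = c + ∑ i, gammaOpTwo t (G i) y := fun y hy => by
    simp only [gammaOpTwo]
    rw [gammaOp_of_eq_add_sum hF hG ht hy, gammaOp_of_eq_add_sum hF hG (mul_pos two_pos ht) hy,
      Finset.sum_sub_distrib, ← Finset.mul_sum]
    ring
  simp only [interpOpTwo]
  rw [h2 _ (by positivity), h2 _ (by positivity), Finset.sum_add_distrib, ← Finset.mul_sum,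
    ← Finset.mul_sum]
  ring

end FiniteMixture

end ErlangMixture

theorem mainTheorem4 {n : ℕ} (a : Fin n → ℝ) (p : Fin n → ℕ+ → ℝ) (F : ℝ → ℝ)
    (hF : IsErlangMixture a p F) (t : ℝ) (ht : 0 < t) :
    GammaOpDefined F ∧
      supNormNonneg (fun x => interpOpTwo t F x - F x) ≤
        ENNReal.ofReal ((17 / 12 + 27 / (16 * Real.exp 1))
          * (∑ i, (∑' j, p i j) * a i ^ 2) / t ^ 2) := by
  have hG : ∀ i, GammaOpDefined fun y => ∑' j, p i j * erlangCDF (a i) j y := by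
    intro i t ht x hx
    have := ErlangMixture.isProbabilityMeasure_gammaProcessLaw (mul_nonneg ht.le hx)
    exact ErlangMixture.integrable_tsum_erlangCDF (hF.weight_nonneg i) (hF.weight_summable i) _ _ _
  refine ⟨fun t ht x hx => ErlangMixture.integrable_of_eq_add_sum hF.eq_mixture ht
    (mul_nonneg ht.le hx) fun i => hG i t ht x hx, iSup_le fun ⟨x, hx⟩ => ?_⟩
  refine ENNReal.ofReal_le_ofReal ?_
  simp only
  rw [ErlangMixture.interpOpTwo_of_eq_add_sum hF.eq_mixture hG ht, hF.eq_mixture x hx,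
    add_sub_add_left_eq_sub, ← Finset.sum_sub_distrib]
  refine (Finset.abs_sum_le_sum_abs _ _).trans ?_
  rw [Finset.mul_sum, Finset.sum_div]
  exact Finset.sum_le_sum fun i _ => ErlangMixture.abs_interpOpTwo_tsum_sub_le
    (hF.weight_nonneg i) (hF.weight_summable i) (hF.param_pos i) ht hx
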